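/- **Setting.** A *disk pattern in $\mathbb{C}$* is a collection $Q$ of closed round disks in $\mathbb{C}$ (of positive finite radius) such that no disk has its boundary contained in the union of two other disks and no disk is the Hausdorff limit of a sequence of distinct disks of $Q$. Its *contact graph* has the disks as vertices, two distinct disks being joined by an edge if they intersect; the *dihedral angle* of two intersecting disks $D_1,D_2$ is the angle between the clockwise tangent of $\partial D_1$ and the counterclockwise tangent of $\partial D_2$ at a point of $\partial D_1\cap\partial D_2$. $Q$ is *locally finite in $\mathbb{C}$* if every compact subset of $\mathbb{C}$ intersects only finitely many disks of $Q$. Let $G$ be a graph with edge set $E$ and let $\Theta:E\to[0,\pi/2]$. Let $\tilde G$ be the graph obtained from $G$ by adding, for every simple loop $a,b,c,d$ in $G$ whose four edges have $\Theta=\pi/2$ and for which $[b,d]$ is an edge of $G$ with $\Theta([b,d])=0$, the edge $[a,c]$ (if it is not already in $G$). Let $\tilde\Theta=\Theta$ on $E$ and $\tilde\Theta=0$ on the added edges. $Q$ *realizes* $(G,\Theta)$ if its contact graph is $\tilde G$ (the disk corresponding to the vertex $v$ is denoted by $Q(v)$) and its dihedral angle function is $\tilde\Theta$. For a set $\Gamma$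 of sets of vertices of $G$ let $\mathrm{MOD}(\Gamma)=\inf_\eta\sum_v\eta(v)^2$ over all $\eta:V\to[0,\infty)$ with $\sum_{v\in\gamma}\eta(v)\ge 1$ for every $\gamma\in\Gamma$, and let $\mathrm{VEL}(\Gamma)=1/\mathrm{MOD}(\Gamma)\in[0,\infty]$. A connected graph $G$ is *VEL-parabolic* if $\mathrm{VEL}(\Gamma)=\infty$, where $\Gamma$ consists of the vertex sets of the paths in $G$ that start in $V_0$ and pass through infinitely many vertices, for a finite nonempty set $V_0$ of vertices (the choice of $V_0$ does not matter). **Corollary 6.2.** Let $T$ be a triangulation of the open topological disk, let $G$ be its one-skeleton, let $\Theta:E\to[0,\pi/2]$ be a function on the set of edges of $G$, and let $Q$ be a disk pattern in $\mathbb{C}$ which realizes $(G,\Theta)$. 1. If $Q$ is locally finite in $\mathbb{C}$, then $G$ is VEL-parabolic. 2. Conversely, suppose that $Q$ is immersed, that is, the map $|T|\to\mathbb{C}$ which is affine on each simplex of $T$ and sends each vertex $v$ to the center of $Q(v)$ is locally injective. If $G$ is VEL-parabolic, then $Q$ is locally finite in $\mathbb{C}$. In particular, for an immersed $Q$, the pattern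 $Q$ is locally finite in $\mathbb{C}$ if and only if $G$ is VEL-parabolic. -/

import Mathlib

open Set Filter Topology
open scoped NNReal ENNReal

noncomputable section

namespace HePattern

/-! ### Triangulations of the open disk -/

variable {V : Type*}

/-- The geometric realization `|T|` of an abstract simplicial complex, by barycentric coordinates:
nonnegative weights, supported in some face of `T`, of total mass `1`. It carries the topology of
pointwise convergence of the barycentric coordinates. On a locally finite complex this is the usual
(weak) topology; a complex whose realization is homeomorphic to the open disk, for either of the
two topologies, is locally finite, so that the two give the same triangulations of the disk. -/
def geomRealization (T : AbstractSimplicialComplex V) : Set (V → ℝ) :=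
  {x | (∀ v, 0 ≤ x v) ∧ ∃ s ∈ T.faces, (∀ v, v ∉ s → x v = 0) ∧ ∑ v ∈ s, x v = 1}

/-- The one-skeleton of `T` as a graph on its vertices: two distinct vertices are joined if they
lie in a common face (equivalently, as faces are closed under passing to nonempty subsets, if they
are the two ends of a 1-simplex of `T`). -/
def oneSkeleton (T : AbstractSimplicialComplex V) : SimpleGraph V where
  Adj u v := u ≠ v ∧ ∃ s ∈ T.faces, u ∈ s ∧ v ∈ s
  symm := ⟨fun _ _ h => ⟨h.1.symm, h.2.imp fun _ hs => ⟨hs.1, hs.2.2, hs.2.1⟩⟩⟩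
  loopless := ⟨fun _ h => h.1 rfl⟩

/-- `T` is a triangulation of the open topological disk: its simplices are vertices, edges and
triangles, and `|T|` is homeomorphic to the open unit disk. -/
def IsOpenDiskTriangulation (T : AbstractSimplicialComplex V) : Prop :=
  (∀ s ∈ T.faces, s.card ≤ 3) ∧ Nonempty (geomRealization T ≃ₜ Metric.ball (0 : ℂ) 1)

/-! ### Disk patterns in the plane -/

/-- A closed round disk in `ℂ`, of positive finite radius. -/
structure PlaneDisk where
  center : ℂ
  radius : ℝ
  radius_pos : 0 < radius

namespace PlaneDisk

/-- The closed disk as a set of points. -/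
def toSet (D : PlaneDisk) : Set ℂ := Metric.closedBall D.center D.radius

/-- The boundary circle. -/
def circle (D : PlaneDisk) : Set ℂ := Metric.sphere D.center D.radius

/-- A counterclockwise tangent vector of the boundary circle of `D` at its point `p`. -/
def ccwTangent (D : PlaneDisk) (p : ℂ) : ℂ := Complex.I * (p - D.center)

/-- A clockwise tangent vector of the boundary circle of `D` at its point `p`. -/
def cwTangent (D : PlaneDisk) (p : ℂ) : ℂ := -D.ccwTangent p

/-- `D₁` and `D₂` have dihedral angle `θ`: this is the angle between the clockwise tangent of
`∂D₁` and the counterclockwise tangent of `∂D₂` at a point of `∂D₁ ∩ ∂D₂`. (If there are two such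
points, they give the same angle, by reflection in the line of centers.) -/
def HasDihedralAngle (D₁ D₂ : PlaneDisk) (θ : ℝ) : Prop :=
  ∃ p ∈ D₁.circle ∩ D₂.circle, InnerProductGeometry.angle (D₁.cwTangent p) (D₂.ccwTangent p) = θ

end PlaneDisk

/-- A disk pattern in `ℂ` whose (pairwise distinct) disks are labelled by `V`: no disk has its
boundary contained in the union of two other disks, and no disk is the Hausdorff limit of a
sequence of distinct disks of the pattern. -/
structure DiskPattern (V : Type*) where
  disk : V → PlaneDisk
  injective : Function.Injective disk
  boundary_not_covered : ∀ u v w : V, v ≠ u → w ≠ u →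
    ¬ (disk u).circle ⊆ (disk v).toSet ∪ (disk w).toSet
  not_hausdorff_limit : ∀ (u : V) (s : ℕ → V), Function.Injective s →
    ¬ Tendsto (fun n => Metric.hausdorffDist (disk (s n)).toSet (disk u).toSet) atTop (𝓝 0)

namespace DiskPattern

/-- The contact graph: two distinct disks are joined by an edge if they intersect. -/
def contactGraph (Q : DiskPattern V) : SimpleGraph V where
  Adj u v := u ≠ v ∧ ((Q.disk u).toSet ∩ (Q.disk v).toSet).Nonempty
  symm := ⟨fun _ _ h => ⟨h.1.symm, by rw [inter_comm]; exact h.2⟩⟩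
  loopless := ⟨fun _ h => h.1 rfl⟩

/-- The pattern is locally finite in `Ω`: all its disks lie in `Ω`, and every compact subset of
`Ω` intersects only finitely many of them. -/
def LocallyFiniteIn (Q : DiskPattern V) (Ω : Set ℂ) : Prop :=
  (∀ v, (Q.disk v).toSet ⊆ Ω) ∧
    ∀ K : Set ℂ, K ⊆ Ω → IsCompact K → {v | ((Q.disk v).toSet ∩ K).Nonempty}.Finite

/-- The map `|T| → ℂ` that sends each vertex to the center of its disk and is affine on each
simplex of `T`. -/
def centerMap (Q : DiskPattern V) (T : AbstractSimplicialComplex V) (x : geomRealization T) : ℂ :=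
  ∑ᶠ v, (x : V → ℝ) v • (Q.disk v).center

/-- The map of `|T|` given by the triangles spanned by the centers of the disks, one for each
2-simplex of `T`, is an immersion into the plane, that is, it is locally injective. -/
def IsImmersed (Q : DiskPattern V) (T : AbstractSimplicialComplex V) : Prop :=
  IsLocallyInjective (Q.centerMap T)

end DiskPattern

/-! ### The data `(G, Θ)` and their realizations -/

/-- `u` and `v` are the ends of an edge of `G` at which the function `Θ` takes the value `θ`. -/
def EdgeValue {G : SimpleGraph V} (Θ : G.edgeSet → ℝ) (u v : V) (θ : ℝ) : Prop :=
  ∃ h : s(u, v) ∈ G.edgeSet, Θ ⟨s(u, v), h⟩ = θ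

/-- `a, b, c, d` is a simple loop in `G` with `Θ = π/2` on its four edges, and its diagonal
`[b, d]` is an edge of `G` with `Θ = 0`. -/
def IsReducibleSquare {G : SimpleGraph V} (Θ : G.edgeSet → ℝ) (a b c d : V) : Prop :=
  a ≠ c ∧ EdgeValue Θ a b (Real.pi / 2) ∧ EdgeValue Θ b c (Real.pi / 2) ∧
    EdgeValue Θ c d (Real.pi / 2) ∧ EdgeValue Θ d a (Real.pi / 2) ∧ EdgeValue Θ b d 0

theorem EdgeValue.symm {G : SimpleGraph V} {Θ : G.edgeSet → ℝ} {u v : V} {θ : ℝ}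
    (h : EdgeValue Θ u v θ) : EdgeValue Θ v u θ := by
  unfold EdgeValue at h ⊢
  rwa [Sym2.eq_swap]

theorem IsReducibleSquare.swap {G : SimpleGraph V} {Θ : G.edgeSet → ℝ} {a b c d : V}
    (h : IsReducibleSquare Θ a b c d) : IsReducibleSquare Θ c b a d :=
  ⟨h.1.symm, h.2.2.1.symm, h.2.1.symm, h.2.2.2.2.1.symm, h.2.2.2.1.symm, h.2.2.2.2.2⟩

/-- The graph `G̃`: the graph `G`, together with the other diagonal `[a, c]` of every loop
`a, b, c, d` as in `IsReducibleSquare`. -/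
def extendedGraph {G : SimpleGraph V} (Θ : G.edgeSet → ℝ) : SimpleGraph V where
  Adj a c := G.Adj a c ∨ ∃ b d, IsReducibleSquare Θ a b c d
  symm := ⟨fun _ _ h => h.imp (fun h => h.symm) fun ⟨b, d, h⟩ => ⟨b, d, h.swap⟩⟩
  loopless := ⟨fun _ h => h.elim (fun h => h.ne rfl) fun ⟨_, _, h⟩ => h.1 rfl⟩

open Classical in
/-- The function `Θ̃`: it is `Θ` on the edges of `G`, and `0` on the added edges. -/
def extendedAngle {G : SimpleGraph V} (Θ : G.edgeSet → ℝ) (e : Sym2 V) : ℝ :=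
  if h : e ∈ G.edgeSet then Θ ⟨e, h⟩ else 0

/-- `Q` realizes the data `(G, Θ)`, the disk `Q.disk v` being the one that corresponds to the
vertex `v`: its contact graph is `G̃` and its dihedral angle function is `Θ̃`. -/
def DiskPattern.Realizes (Q : DiskPattern V) {G : SimpleGraph V} (Θ : G.edgeSet → ℝ) : Prop :=
  Q.contactGraph = extendedGraph Θ ∧
    ∀ u v, (extendedGraph Θ).Adj u v →
      (Q.disk u).HasDihedralAngle (Q.disk v) (extendedAngle Θ s(u, v))

/-! ### Vertex extremal length -/

/-- The area of a vertex metric. -/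
def area (η : V → ℝ≥0) : ℝ≥0∞ := ∑' v, (η v : ℝ≥0∞) ^ 2

/-- The length of a vertex curve, that is, of a set of vertices. -/
def length (η : V → ℝ≥0) (γ : Set V) : ℝ≥0∞ := ∑' v : γ, (η v : ℝ≥0∞)

/-- A vertex metric is admissible for a collection of vertex curves if they all have
length at least `1`. -/
def Admissible (Γ : Set (Set V)) (η : V → ℝ≥0) : Prop := ∀ γ ∈ Γ, 1 ≤ length η γ

/-- The vertex modulus. -/
def vertexModulus (Γ : Set (Set V)) : ℝ≥0∞ := ⨅ (η : V → ℝ≥0) (_ : Admissible Γ η), area η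

/-- The vertex extremal length; here `0⁻¹ = ∞` and `∞⁻¹ = 0`, and it is `∞` for the empty
collection. -/
def vertexExtremalLength (Γ : Set (Set V)) : ℝ≥0∞ := (vertexModulus Γ)⁻¹

/-- The vertex curves of the paths in `G` that join `V₀` and `∞`: the paths that start at a vertex
of `V₀` and pass through infinitely many vertices. -/
def curvesToInfinity (G : SimpleGraph V) (V₀ : Set V) : Set (Set V) :=
  {γ | ∃ p : ℕ → V, p 0 ∈ V₀ ∧ (∀ k, G.Adj (p k) (p (k + 1))) ∧ (range p).Infinite ∧ γ = range p}

/-- `G` is VEL-parabolic: it is connected, and `VEL(V₀, ∞) = ∞` for a finite nonvoid set `V₀` of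
vertices. (In a connected graph this does not depend on the choice of `V₀`.) -/
def VELParabolic (G : SimpleGraph V) : Prop :=
  G.Connected ∧ ∃ V₀ : Set V, V₀.Finite ∧ V₀.Nonempty ∧
    vertexExtremalLength (curvesToInfinity G V₀) = ⊤

end HePattern

end

open HePattern

/-!
At angles at most `π / 2` no point is interior to more than four disks, so the disks that meet a
bounded region have bounded total area once their radii are truncated at a fixed bound.

If `Q` is locally finite, the radii of the disks, truncated and normalized, therefore give metrics
of bounded area on the annuli around a fixed disk. Infinitely many of these annuli meet pairwise
disjoint sets of disks and each is crossed by every path to infinity; so the modulus vanishes.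

Conversely, let `Q` be immersed. The center map is open by invariance of domain. It is injective,
because an edge that enters a triangle not containing its ends must cross a side of it, and at
angles at most `π / 2` two crossing edges with distinct ends join tangent disks with the same point
of tangency. It is also surjective when `G` is parabolic. Otherwise take a circle around an omitted
point `p` that meets the image. It is not contained in the image, which is simply connected, and
following it from a point of the image to the boundary of the image gives a path to infinity in `G`.
This holds for an interval of radii, although the squares of the lengths of the intervals of radii
whose circles meet a given disk have a finite sum; so the length–area inequality contradicts the
vanishing of the modulus. Hence the center map is a homeomorphism onto the plane. Over a compact set
it only meets finitely many stars, which gives local finiteness for the small disks, and the large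
disks are controlled by their area.
-/

noncomputable section

namespace HePattern

variable {V : Type*}

/-! ### Disks meeting at angles at most `π / 2` -/

theorem PlaneDisk.HasDihedralAngle.dist_sq {D₁ D₂ : PlaneDisk} {θ : ℝ}
    (h : D₁.HasDihedralAngle D₂ θ) :
    dist D₁.center D₂.center ^ 2 =
      D₁.radius ^ 2 + D₂.radius ^ 2 + 2 * D₁.radius * D₂.radius * Real.cos θ := by
  obtain ⟨p, ⟨h₁, h₂⟩, rfl⟩ := h
  have norm₁ : ‖p - D₁.center‖ = D₁.radius := (dist_eq_norm _ _).symm.trans h₁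
  have norm₂ : ‖p - D₂.center‖ = D₂.radius := (dist_eq_norm _ _).symm.trans h₂
  have inner_tangents : inner ℝ (D₁.cwTangent p) (D₂.ccwTangent p) =
      D₁.radius * D₂.radius * Real.cos
        (InnerProductGeometry.angle (D₁.cwTangent p) (D₂.ccwTangent p)) := by
    rw [← InnerProductGeometry.cos_angle_mul_norm_mul_norm]
    simp only [PlaneDisk.cwTangent, PlaneDisk.ccwTangent, norm_neg, norm_mul, Complex.norm_I,
      one_mul, norm₁, norm₂]
    ring
  have inner_radii : inner ℝ (D₁.cwTangent p) (D₂.ccwTangent p) =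
      -inner ℝ (p - D₁.center) (p - D₂.center) := by
    simp only [PlaneDisk.cwTangent, PlaneDisk.ccwTangent, Complex.inner]
    simp
    ring
  have polarization := norm_sub_sq_real (p - D₂.center) (p - D₁.center)
  rw [sub_sub_sub_cancel_left, ← dist_eq_norm, norm₁, norm₂, real_inner_comm] at polarization
  linarith

theorem DiskPattern.contactGraph_adj_iff (Q : DiskPattern V) (u v : V) :
    Q.contactGraph.Adj u v ↔
      u ≠ v ∧ dist (Q.disk u).center (Q.disk v).center ≤ (Q.disk u).radius + (Q.disk v).radius := by
  refine and_congr_right fun _ => ⟨?_, fun h => ?_⟩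
  · rintro ⟨z, hu, hv⟩
    exact (dist_triangle_left _ _ z).trans (add_le_add hu hv)
  · obtain ⟨z, hu, hv⟩ := exists_dist_le_le (Q.disk u).radius_pos.le (Q.disk v).radius_pos.le
      (h.trans_eq (add_comm _ _))
    exact ⟨z, by rwa [dist_comm] at hu, hv⟩

/-- Distinct disks of the pattern meet at an angle at most `π / 2`, or are disjoint. -/
def DiskPattern.Nonobtuse (Q : DiskPattern V) : Prop :=
  ∀ u v, u ≠ v → (Q.disk u).radius ^ 2 + (Q.disk v).radius ^ 2 ≤
    dist (Q.disk u).center (Q.disk v).center ^ 2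

/-- What the realization of `(G, Θ)` with `Θ ≤ π / 2` says about centers and radii alone: the
pattern is nonobtuse, the disks of adjacent vertices meet, and orthogonal disks belong to adjacent
vertices. Disjoint or tangent disks may belong to nonadjacent vertices, which absorbs the
additional edges of `extendedGraph`. -/
structure DiskPattern.MetricallyRealizes (Q : DiskPattern V) (G : SimpleGraph V) : Prop where
  nonobtuse : Q.Nonobtuse
  dist_le_of_adj : ∀ ⦃u v⦄, G.Adj u v →
    dist (Q.disk u).center (Q.disk v).center ≤ (Q.disk u).radius + (Q.disk v).radius
  adj_of_dist_sq_eq : ∀ ⦃u v⦄, u ≠ v → dist (Q.disk u).center (Q.disk v).center ^ 2 =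
    (Q.disk u).radius ^ 2 + (Q.disk v).radius ^ 2 → G.Adj u v

section Realizes

variable {G : SimpleGraph V} {Θ : G.edgeSet → ℝ} {Q : DiskPattern V}

theorem extendedAngle_mem_Icc (hΘ : ∀ e, Θ e ∈ Icc 0 (Real.pi / 2)) (e : Sym2 V) :
    extendedAngle Θ e ∈ Icc 0 (Real.pi / 2) := by
  unfold extendedAngle
  split_ifs
  · exact hΘ _
  · exact ⟨le_rfl, by positivity⟩

theorem DiskPattern.Realizes.nonobtuse (hQ : Q.Realizes Θ)
    (hΘ : ∀ e, Θ e ∈ Icc 0 (Real.pi / 2)) : Q.Nonobtuse := by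
  intro u v huv
  have hu := (Q.disk u).radius_pos
  have hv := (Q.disk v).radius_pos
  by_cases h : Q.contactGraph.Adj u v
  · have cos_nonneg : 0 ≤ Real.cos (extendedAngle Θ s(u, v)) := by
      obtain ⟨h₀, h₁⟩ := extendedAngle_mem_Icc hΘ s(u, v)
      exact Real.cos_nonneg_of_neg_pi_div_two_le_of_le (by linarith [Real.pi_pos]) h₁
    rw [(hQ.2 u v (hQ.1 ▸ h)).dist_sq]
    exact le_add_of_nonneg_right (by positivity)
  · rw [Q.contactGraph_adj_iff] at h
    push Not at h
    nlinarith [h huv]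

theorem DiskPattern.Realizes.dist_le_of_adj (hQ : Q.Realizes Θ) {u v : V} (h : G.Adj u v) :
    dist (Q.disk u).center (Q.disk v).center ≤ (Q.disk u).radius + (Q.disk v).radius :=
  ((Q.contactGraph_adj_iff u v).1 (hQ.1 ▸ Or.inl h)).2

theorem DiskPattern.Realizes.adj_of_dist_sq_eq (hQ : Q.Realizes Θ) {u v : V} (huv : u ≠ v)
    (h : dist (Q.disk u).center (Q.disk v).center ^ 2 =
      (Q.disk u).radius ^ 2 + (Q.disk v).radius ^ 2) : G.Adj u v := by
  have hu := (Q.disk u).radius_pos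
  have hv := (Q.disk v).radius_pos
  have contact : Q.contactGraph.Adj u v :=
    (Q.contactGraph_adj_iff u v).2 ⟨huv, abs_le_of_sq_le_sq' (by nlinarith) (by positivity) |>.2⟩
  -- An added edge would make the two disks tangent instead of orthogonal.
  by_contra hG
  have angle_eq : extendedAngle Θ s(u, v) = 0 := dif_neg hG
  have tangent := (hQ.2 u v (hQ.1 ▸ contact)).dist_sq
  rw [angle_eq, h, Real.cos_zero] at tangent
  nlinarith [mul_pos hu hv]

theorem DiskPattern.Realizes.metricallyRealizes (hQ : Q.Realizes Θ)
    (hΘ : ∀ e, Θ e ∈ Icc 0 (Real.pi / 2)) : Q.MetricallyRealizes G :=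
  ⟨hQ.nonobtuse hΘ, fun _ _ => hQ.dist_le_of_adj, fun _ _ => hQ.adj_of_dist_sq_eq⟩

end Realizes

section Crossing

open AffineMap

variable {E : Type*} [NormedAddCommGroup E] [InnerProductSpace ℝ E]

theorem dist_sq_lineMap (a b x : E) (s : ℝ) :
    dist x (lineMap a b s) ^ 2 =
      (1 - s) * dist x a ^ 2 + s * dist x b ^ 2 - s * (1 - s) * dist a b ^ 2 := by
  have h₁ : x - lineMap a b s = (1 - s) • (x - a) + s • (x - b) := by
    rw [lineMap_apply_module]
    module
  have h₂ : a - b = (x - b) - (x - a) := (sub_sub_sub_cancel_left _ _ _).symm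
  have expand := norm_add_sq_real ((1 - s) • (x - a)) (s • (x - b))
  have polarization := norm_sub_sq_real (x - b) (x - a)
  rw [← h₁, norm_smul, norm_smul, mul_pow, mul_pow, Real.norm_eq_abs, Real.norm_eq_abs, sq_abs,
    sq_abs, real_inner_smul_left, real_inner_smul_right, real_inner_comm] at expand
  simp only [dist_eq_norm, h₂]
  linear_combination expand + s * (1 - s) * polarization

/-- The quantity `dist x a ^ 2 - ra ^ 2` is the power of `x` with respect to the sphere of center
`a` and radius `ra`. -/
theorem combination_power_le {a b : E} {ra rb s : ℝ} (hs : s ∈ Icc (0 : ℝ) 1)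
    (hab : dist a b ≤ ra + rb) (x : E) :
    (1 - s) * (dist x a ^ 2 - ra ^ 2) + s * (dist x b ^ 2 - rb ^ 2) ≤
      dist x (lineMap a b s) ^ 2 - ((1 - s) * ra - s * rb) ^ 2 := by
  have h := mul_le_mul_of_nonneg_left (pow_le_pow_left₀ dist_nonneg hab 2)
    (mul_nonneg hs.1 (sub_nonneg.2 hs.2))
  rw [dist_sq_lineMap]
  linarith

theorem lineMap_eq_tangency_of_eq {a b : E} {ra rb s : ℝ} (hr : ra + rb ≠ 0)
    (h : (1 - s) * ra - s * rb = 0) : lineMap a b s = lineMap (k := ℝ) a b (ra / (ra + rb)) := by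
  congr
  field_simp
  linarith

/- At the crossing point the powers with respect to the balls bound each other from both sides along
the two segments, so all these inequalities are equalities. -/
theorem tangency_of_mem_segment_inter {a b c d z : E} {ra rb rc rd : ℝ}
    (ha : 0 < ra) (hb : 0 < rb) (hc : 0 < rc) (hd : 0 < rd)
    (hab : dist a b ≤ ra + rb) (hcd : dist c d ≤ rc + rd)
    (hac : ra ^ 2 + rc ^ 2 ≤ dist a c ^ 2) (had : ra ^ 2 + rd ^ 2 ≤ dist a d ^ 2)
    (hbc : rb ^ 2 + rc ^ 2 ≤ dist b c ^ 2) (hbd : rb ^ 2 + rd ^ 2 ≤ dist b d ^ 2)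
    (hz : z ∈ segment ℝ a b) (hz' : z ∈ segment ℝ c d) :
    z = lineMap c d (rc / (rc + rd)) ∧ dist a c ^ 2 = ra ^ 2 + rc ^ 2 := by
  rw [segment_eq_image_lineMap] at hz hz'
  obtain ⟨s, hs, rfl⟩ := hz
  obtain ⟨t, ht, hst⟩ := hz'
  obtain ⟨hs₀, hs₁⟩ := hs
  obtain ⟨ht₀, ht₁⟩ := ht
  rw [dist_comm a] at hac had ⊢
  rw [dist_comm b] at hbc hbd
  have power_c : rc ^ 2 ≤ dist c (lineMap a b s) ^ 2 - ((1 - s) * ra - s * rb) ^ 2 :=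
    le_trans (by nlinarith) (combination_power_le ⟨hs₀, hs₁⟩ hab c)
  have power_d : rd ^ 2 ≤ dist d (lineMap a b s) ^ 2 - ((1 - s) * ra - s * rb) ^ 2 :=
    le_trans (by nlinarith) (combination_power_le ⟨hs₀, hs₁⟩ hab d)
  have power_z := combination_power_le ⟨ht₀, ht₁⟩ hcd (lineMap a b s)
  rw [hst, dist_self, dist_comm _ c, dist_comm _ d] at power_z
  have ratio_s : (1 - s) * ra - s * rb = 0 := pow_eq_zero_iff two_ne_zero |>.1 (by nlinarith)
  have ratio_t : (1 - t) * rc - t * rd = 0 := pow_eq_zero_iff two_ne_zero |>.1 (by nlinarith)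
  have s_lt : s < 1 := by nlinarith
  have t_lt : t < 1 := by nlinarith
  refine ⟨by rw [← lineMap_eq_tangency_of_eq (by positivity) ratio_t, hst], hac.antisymm' ?_⟩
  rw [ratio_s] at power_d
  have touch_c : dist c (lineMap a b s) ^ 2 ≤ rc ^ 2 := by
    refine sub_nonpos.1 (nonpos_of_mul_nonpos_right (a := 1 - t) ?_ (by linarith))
    nlinarith
  have := combination_power_le ⟨hs₀, hs₁⟩ hab c
  rw [ratio_s] at this
  refine sub_nonpos.1 (nonpos_of_mul_nonpos_right (a := 1 - s) ?_ (by linarith))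
  nlinarith

end Crossing

theorem exists_pow_I_mul_mem_quadrant {w : ℂ} (hw : w ≠ 0) :
    ∃ k : Fin 4, 0 < (Complex.I ^ (k : ℕ) * w).re ∧ 0 ≤ (Complex.I ^ (k : ℕ) * w).im := by
  rcases lt_trichotomy w.re 0 with hre | hre | hre <;>
    rcases lt_trichotomy w.im 0 with him | him | him
  · exact ⟨2, by simp [hre, him.le]⟩
  · exact ⟨2, by simp [hre, him.le]⟩
  · exact ⟨3, by simp [Complex.I_pow_three, him, hre.le]⟩
  · exact ⟨1, by simp [hre, him]⟩
  · exact absurd (Complex.ext hre him) hw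
  · exact ⟨3, by simp [Complex.I_pow_three, hre, him]⟩
  · exact ⟨1, by simp [hre.le, him]⟩
  · exact ⟨0, by simp [hre, him]⟩
  · exact ⟨0, by simp [hre, him.le]⟩

theorem encard_le_four_of_inner_nonpos {ι : Type*} {S : Set ι} {w : ι → ℂ}
    (hw : ∀ i ∈ S, w i ≠ 0) (h : S.Pairwise fun i j => inner ℝ (w i) (w j) ≤ 0) :
    S.encard ≤ 4 := by
  choose! k hk using fun i hi => exists_pow_I_mul_mem_quadrant (hw i hi)
  have hinj : InjOn k S := by
    refine fun i hi j hj hij => by_contra fun hne => (h hi hj hne).not_gt ?_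
    have hki := hk i hi
    have hkj := hk j hj
    rw [← hij] at hkj
    have rotation (m : ℕ) :
        inner ℝ (Complex.I ^ m * w i) (Complex.I ^ m * w j) = inner ℝ (w i) (w j) := by
      rw [Complex.inner, map_mul, mul_mul_mul_comm, Complex.mul_conj]
      simp [Complex.inner]
    rw [← rotation (k i), Complex.inner, Complex.mul_re, Complex.conj_re, Complex.conj_im]
    nlinarith [mul_pos hki.1 hkj.1, mul_nonneg hki.2 hkj.2]
  calc S.encard = (k '' S).encard := hinj.encard_image.symm
    _ ≤ (univ : Set (Fin 4)).encard := encard_le_encard (subset_univ _)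
    _ = 4 := by simp

section Packing

open MeasureTheory

theorem tsum_measure_le_of_encard_le {α ι : Type*} [MeasurableSpace α] [Countable ι]
    (μ : Measure α) {A : ι → Set α} {B : Set α} {n : ℕ∞} (hA : ∀ i, MeasurableSet (A i))
    (hAB : ∀ i, A i ⊆ B) (hn : ∀ x, {i | x ∈ A i}.encard ≤ n) : ∑' i, μ (A i) ≤ n * μ B := by
  have multiplicity (x : α) : ∑' i, (A i).indicator (1 : α → ℝ≥0∞) x = {i | x ∈ A i}.encard := by
    rw [← ENNReal.tsum_set_one, tsum_subtype {i | x ∈ A i} fun _ => (1 : ℝ≥0∞)]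
    rfl
  calc ∑' i, μ (A i) = ∑' i, ∫⁻ x, (A i).indicator 1 x ∂μ :=
        tsum_congr fun i => (lintegral_indicator_one (hA i)).symm
    _ = ∫⁻ x, ∑' i, (A i).indicator 1 x ∂μ :=
        (lintegral_tsum fun i => (measurable_one.indicator (hA i)).aemeasurable).symm
    _ ≤ ∫⁻ x, B.indicator (fun _ => (n : ℝ≥0∞)) x ∂μ := by
        refine lintegral_mono fun x => ?_
        simp only [multiplicity]
        by_cases hx : x ∈ B
        · simpa [hx] using hn x
        · have : {i | x ∈ A i} = ∅ := eq_empty_of_forall_notMem fun i hi => hx (hAB i hi)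
          simp [this]
    _ ≤ n * μ B := lintegral_indicator_const_le _ _

end Packing

theorem PlaneDisk.exists_closedBall_subset (D : PlaneDisk) {p : ℂ} {M R : ℝ} (hR : 0 < R)
    (h : (D.toSet ∩ Metric.closedBall p M).Nonempty) :
    ∃ c, Metric.closedBall c (min D.radius R) ⊆ D.toSet ∩ Metric.closedBall p (M + 2 * R) := by
  obtain ⟨z, hzD : dist z D.center ≤ D.radius, hzp : dist z p ≤ M⟩ := h
  obtain ⟨c, hcD, hcz⟩ := exists_dist_le_le (x := z) (z := D.center) (δ := min D.radius R)
    (le_min D.radius_pos.le hR.le) (sub_nonneg.2 (min_le_left D.radius R)) (by simpa using hzD)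
  refine ⟨c, subset_inter (Metric.closedBall_subset_closedBall' ?_)
    (Metric.closedBall_subset_closedBall' ?_)⟩
  · linarith
  · linarith [dist_triangle_left c p z, min_le_right D.radius R]

namespace DiskPattern.Nonobtuse

variable {Q : DiskPattern V}

theorem encard_le (hQ : Q.Nonobtuse) (z : ℂ) : {v | z ∈ (Q.disk v).toSet}.encard ≤ 4 := by
  have dist_le {v} (hv : z ∈ (Q.disk v).toSet) : ‖(Q.disk v).center - z‖ ≤ (Q.disk v).radius := by
    rwa [← dist_eq_norm, dist_comm]
  rcases {v | z ∈ (Q.disk v).toSet}.subsingleton_or_nontrivial with h | h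
  · exact (encard_le_one_iff_subsingleton.2 h).trans (by norm_num)
  refine encard_le_four_of_inner_nonpos (w := fun v => (Q.disk v).center - z) ?_ ?_
  · intro v _ hv₀
    obtain ⟨u, hu, huv⟩ := h.exists_ne v
    have angle := hQ u v huv
    rw [sub_eq_zero.1 hv₀, dist_eq_norm] at angle
    linarith [pow_le_pow_left₀ (norm_nonneg _) (dist_le hu) 2, sq_pos_of_pos (Q.disk v).radius_pos]
  · intro u hu v hv huv
    have polarization := norm_sub_sq_real ((Q.disk u).center - z) ((Q.disk v).center - z)
    rw [sub_sub_sub_cancel_right, ← dist_eq_norm] at polarization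
    linarith [hQ u v huv, pow_le_pow_left₀ (norm_nonneg _) (dist_le hu) 2,
      pow_le_pow_left₀ (norm_nonneg _) (dist_le hv) 2]

theorem countable (hQ : Q.Nonobtuse) : Countable V := by
  have hdisjoint : (univ : Set V).PairwiseDisjoint
      fun v => Metric.ball (Q.disk v).center ((Q.disk v).radius / 2) := by
    refine fun u _ v _ huv => Metric.ball_disjoint_ball (abs_le_of_sq_le_sq' ?_ dist_nonneg).2
    nlinarith [hQ u v huv, sq_nonneg ((Q.disk u).radius - (Q.disk v).radius)]
  exact countable_univ_iff.1 <| hdisjoint.countable_of_isOpen (fun _ _ => Metric.isOpen_ball)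
    fun v _ => Metric.nonempty_ball.2 (half_pos (Q.disk v).radius_pos)

theorem tsum_sq_le (hQ : Q.Nonobtuse) (p : ℂ) {M R : ℝ} (hR : 0 < R) :
    ∑' v : {v | ((Q.disk v).toSet ∩ Metric.closedBall p M).Nonempty},
      ENNReal.ofReal (min (Q.disk v).radius R) ^ 2 ≤ 4 * ENNReal.ofReal (M + 2 * R) ^ 2 := by
  have := hQ.countable
  set S := {v | ((Q.disk v).toSet ∩ Metric.closedBall p M).Nonempty}
  choose c hc using fun v : S => (Q.disk v).exists_closedBall_subset hR v.2
  have packing := tsum_measure_le_of_encard_le (n := 4) MeasureTheory.volume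
    (fun v => Metric.isClosed_closedBall.measurableSet) (fun v => (hc v).trans inter_subset_right)
    fun z => calc
      {v | z ∈ Metric.closedBall (c v) (min (Q.disk v).radius R)}.encard
          ≤ (Subtype.val ⁻¹' {v | z ∈ (Q.disk v).toSet} : Set S).encard :=
        encard_le_encard fun v hv => (hc v hv).1
      _ ≤ {v | z ∈ (Q.disk v).toSet}.encard :=
        encard_preimage_val_le_encard_right _ _
      _ ≤ 4 := hQ.encard_le z
  simp only [Complex.volume_closedBall, ENNReal.tsum_mul_right] at packing
  rw [← mul_assoc] at packing
  exact (ENNReal.mul_le_mul_iff_left (by simp [NNReal.pi_ne_zero]) (by simp)).1 packing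

theorem finite_setOf_one_le_radius (hQ : Q.Nonobtuse) (p : ℂ) (M : ℝ) :
    {v | ((Q.disk v).toSet ∩ Metric.closedBall p M).Nonempty ∧ 1 ≤ (Q.disk v).radius}.Finite := by
  have h := (hQ.tsum_sq_le p (M := M) one_pos).trans_lt
    (ENNReal.mul_lt_top (by simp) (ENNReal.pow_lt_top ENNReal.ofReal_lt_top))
  refine ((ENNReal.finite_const_le_of_tsum_ne_top h.ne one_ne_zero).image Subtype.val).subset ?_
  rintro v ⟨hv, hr⟩
  refine ⟨⟨v, hv⟩, ?_, rfl⟩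
  change 1 ≤ ENNReal.ofReal _ ^ 2
  rw [min_eq_right hr, ENNReal.ofReal_one, one_pow]

end DiskPattern.Nonobtuse

/-! ### Vertex extremal length -/

theorem length_const_mul (c : ℝ≥0) (η : V → ℝ≥0) (γ : Set V) :
    length (fun v => c * η v) γ = c * length η γ := by
  simp [length, ENNReal.tsum_mul_left]

theorem area_const_mul (c : ℝ≥0) (η : V → ℝ≥0) :
    area (fun v => c * η v) = (c : ℝ≥0∞) ^ 2 * area η := by
  simp [area, mul_pow, ENNReal.tsum_mul_left]

theorem length_add (η η' : V → ℝ≥0) (γ : Set V) :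
    length (η + η') γ = length η γ + length η' γ := by
  simp [length, ENNReal.tsum_add]

theorem area_add_of_disjoint_support {η η' : V → ℝ≥0}
    (h : Disjoint (Function.support η) (Function.support η')) :
    area (η + η') = area η + area η' := by
  rw [area, area, area, ← ENNReal.tsum_add]
  refine tsum_congr fun v => ?_
  by_cases hv : η v = 0
  · simp [hv]
  · simp [Function.notMem_support.1 (disjoint_left.1 h hv)]

theorem sq_mul_vertexModulus_le_area {Γ : Set (Set V)} {η : V → ℝ≥0} {c : ℝ≥0}
    (h : ∀ γ ∈ Γ, c ≤ length η γ) : (c : ℝ≥0∞) ^ 2 * vertexModulus Γ ≤ area η := by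
  rcases eq_or_ne c 0 with rfl | hc
  · simp
  have hadm : Admissible Γ fun v => c⁻¹ * η v := fun γ hγ => by
    rw [length_const_mul, ENNReal.coe_inv hc,
      ← ENNReal.inv_mul_cancel (a := c) (by simpa) (by simp)]
    gcongr
    exact h γ hγ
  calc (c : ℝ≥0∞) ^ 2 * vertexModulus Γ ≤ (c : ℝ≥0∞) ^ 2 * area fun v => c⁻¹ * η v :=
        mul_le_mul_right (iInf₂_le _ hadm) _
    _ = area η := by
        rw [area_const_mul, ← mul_assoc, ← mul_pow, ENNReal.coe_inv hc,
          ENNReal.mul_inv_cancel (by simpa) (by simp), one_pow, one_mul]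

section DisjointMetrics

variable {Γ : Set (Set V)} {C : ℝ≥0∞}

theorem exists_area_le_mul_le_length
    (h : ∀ S : Set V, S.Finite → ∃ η : V → ℝ≥0, area η ≤ C ∧ (Function.support η).Finite ∧
      Disjoint S (Function.support η) ∧ Admissible Γ η) (n : ℕ) :
    ∃ η : V → ℝ≥0, area η ≤ n * C ∧ (Function.support η).Finite ∧
      ∀ γ ∈ Γ, n ≤ length η γ := by
  induction n with
  | zero => exact ⟨0, by simp [area], by simp, by simp⟩
  | succ n ih =>
    obtain ⟨η, area_le, finite, le_length⟩ := ih
    obtain ⟨η', area_le', finite', disjoint, admissible⟩ := h _ finite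
    refine ⟨η + η', ?_, (finite.union finite').subset (Function.support_add _ _), fun γ hγ => ?_⟩
    · rw [area_add_of_disjoint_support disjoint, Nat.cast_succ, add_mul, one_mul]
      exact add_le_add area_le area_le'
    · rw [length_add, Nat.cast_succ]
      exact add_le_add (le_length γ hγ) (admissible γ hγ)

theorem vertexModulus_eq_zero_of_disjoint_metrics (hC : C ≠ ⊤)
    (h : ∀ S : Set V, S.Finite → ∃ η : V → ℝ≥0, area η ≤ C ∧ (Function.support η).Finite ∧
      Disjoint S (Function.support η) ∧ Admissible Γ η) : vertexModulus Γ = 0 := by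
  by_contra hΓ
  obtain ⟨n, hn⟩ := ENNReal.exists_nat_mul_gt hΓ hC
  have hn₀ : (n : ℝ≥0∞) ≠ 0 := by
    rintro h₀
    simp [h₀] at hn
  obtain ⟨η, area_le, -, le_length⟩ := exists_area_le_mul_le_length h n
  have hle : (n : ℝ≥0∞) * (n * vertexModulus Γ) ≤ n * C := by
    rw [← mul_assoc, ← sq]
    exact (sq_mul_vertexModulus_le_area (c := n) (by simpa using le_length)).trans area_le
  exact hn.not_ge ((ENNReal.mul_le_mul_iff_right hn₀ (ENNReal.natCast_ne_top n)).1 hle)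

end DisjointMetrics

/-! ### Locally finite patterns are parabolic -/

theorem exists_nonempty_inter_sphere_of_chain {X : Type*} [PseudoMetricSpace X] {A : ℕ → Set X}
    (hA : ∀ k, IsPreconnected (A k)) (hchain : ∀ k, (A k ∩ A (k + 1)).Nonempty) {p : X} {t : ℝ}
    (hin : ∃ k, (A k ∩ Metric.closedBall p t).Nonempty) (hout : ∃ k, ¬ A k ⊆ Metric.ball p t) :
    ∃ k, (A k ∩ Metric.sphere p t).Nonempty := by
  obtain ⟨i, x, hxi, hx⟩ := hin
  obtain ⟨j, hj⟩ := hout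
  obtain ⟨y, hyj, hy⟩ := not_subset.1 hj
  obtain ⟨z, hz, hzt⟩ := (IsPreconnected.iUnion_of_chain hA hchain).intermediate_value
    (mem_iUnion_of_mem i hxi) (mem_iUnion_of_mem j hyj) (f := (dist · p)) (by fun_prop)
    ⟨hx, not_lt.1 hy⟩
  obtain ⟨k, hzk⟩ := mem_iUnion.1 hz
  exact ⟨k, z, hzk, hzt⟩

section AnnulusMetric

open MeasureTheory

variable {Q : DiskPattern V} {p : ℂ} {R : ℝ}

theorem PlaneDisk.volume_dist_image_le (D : PlaneDisk) (p : ℂ) :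
    volume ((dist · p) '' D.toSet) ≤ ENNReal.ofReal (2 * D.radius) := by
  have hsub : (dist · p) '' D.toSet ⊆ Metric.closedBall (dist D.center p) D.radius := by
    rintro _ ⟨z, hz, rfl⟩
    exact (abs_dist_sub_le z D.center p).trans hz
  exact (measure_mono hsub).trans_eq (Real.volume_closedBall _ _)

open Classical in
/-- The metric that assigns to each disk which meets the annulus between the circles of radii `R`
and `2 * R` about `p` its diameter, truncated at the width of the annulus and divided by it. -/
def annulusMetric (Q : DiskPattern V) (p : ℂ) (R : ℝ) (v : V) : ℝ≥0 :=
  if ((Q.disk v).toSet ∩ Metric.closedBall p (2 * R)).Nonempty ∧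
      ¬ (Q.disk v).toSet ⊆ Metric.ball p R then
    (min (2 * (Q.disk v).radius) R / R).toNNReal else 0

theorem area_annulusMetric_le (hQ : Q.Nonobtuse) (hR : 0 < R) :
    area (annulusMetric Q p R) ≤ 256 := by
  set S := {v | ((Q.disk v).toSet ∩ Metric.closedBall p (2 * R)).Nonempty}
  have metric_le (v : V) : (annulusMetric Q p R v : ℝ≥0∞) ^ 2 ≤ S.indicator (fun v =>
      ENNReal.ofReal (2 / R) ^ 2 * ENNReal.ofReal (min (Q.disk v).radius R) ^ 2) v := by
    unfold annulusMetric
    split_ifs with hv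
    · rw [indicator_of_mem (s := S) hv.1, ← mul_pow, ← ENNReal.ofReal_mul (by positivity),
        div_mul_eq_mul_div, mul_min_of_nonneg _ _ zero_le_two]
      exact pow_le_pow_left' (ENNReal.ofReal_le_ofReal (div_le_div_of_nonneg_right
        (min_le_min le_rfl (by linarith)) hR.le)) 2
    · simp
  calc area (annulusMetric Q p R)
      ≤ ∑' v : S, ENNReal.ofReal (2 / R) ^ 2 * ENNReal.ofReal (min (Q.disk v).radius R) ^ 2 := by
        rw [tsum_subtype S fun v => ENNReal.ofReal (2 / R) ^ 2 *
          ENNReal.ofReal (min (Q.disk v).radius R) ^ 2]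
        exact ENNReal.tsum_le_tsum metric_le
    _ ≤ ENNReal.ofReal (2 / R) ^ 2 * (4 * ENNReal.ofReal (2 * R + 2 * R) ^ 2) := by
        rw [ENNReal.tsum_mul_left]
        exact mul_le_mul_right (hQ.tsum_sq_le p hR) _
    _ = 256 := by
        rw [mul_left_comm, ← mul_pow, ← ENNReal.ofReal_mul (by positivity),
          show 2 / R * (2 * R + 2 * R) = 8 by field_simp; norm_num]
        norm_num

theorem volume_inter_dist_image_le_annulusMetric (hR : 0 < R) (v : V) :
    volume (Ioo R (2 * R) ∩ (dist · p) '' (Q.disk v).toSet) ≤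
      ENNReal.ofReal R * annulusMetric Q p R v := by
  unfold annulusMetric
  split_ifs with hv
  · rw [← ENNReal.ofReal.eq_1, ← ENNReal.ofReal_mul hR.le, mul_div_cancel₀ _ hR.ne',
      ENNReal.ofReal_min]
    refine le_min ((measure_mono inter_subset_right).trans
      ((Q.disk v).volume_dist_image_le p)) ((measure_mono inter_subset_left).trans_eq ?_)
    rw [Real.volume_Ioo, two_mul, add_sub_cancel_right]
  · suffices Ioo R (2 * R) ∩ (dist · p) '' (Q.disk v).toSet = ∅ by simp [this]
    refine eq_empty_of_forall_notMem ?_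
    rintro _ ⟨ht, z, hz, rfl⟩
    exact hv ⟨⟨z, hz, ht.2.le⟩, fun hsub => (hsub hz : dist z p < R).not_gt ht.1⟩

theorem one_le_length_annulusMetric [Countable V] (hR : 0 < R) {γ : Set V}
    (h : ∀ t ∈ Ioo R (2 * R), ∃ v ∈ γ, ((Q.disk v).toSet ∩ Metric.sphere p t).Nonempty) :
    1 ≤ length (annulusMetric Q p R) γ := by
  have cover : Ioo R (2 * R) ⊆ ⋃ v : γ, Ioo R (2 * R) ∩ (dist · p) '' (Q.disk v).toSet := by
    intro t ht
    obtain ⟨v, hv, z, hz, hzt⟩ := h t ht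
    exact mem_iUnion.2 ⟨⟨v, hv⟩, ht, z, hz, hzt⟩
  have width_le : ENNReal.ofReal R ≤ ENNReal.ofReal R * length (annulusMetric Q p R) γ :=
    calc ENNReal.ofReal R = volume (Ioo R (2 * R)) := by
          rw [Real.volume_Ioo, two_mul, add_sub_cancel_right]
      _ ≤ ∑' v : γ, volume (Ioo R (2 * R) ∩ (dist · p) '' (Q.disk v).toSet) :=
          (measure_mono cover).trans (measure_iUnion_le _)
      _ ≤ ∑' v : γ, ENNReal.ofReal R * annulusMetric Q p R v :=
          ENNReal.tsum_le_tsum fun v => volume_inter_dist_image_le_annulusMetric hR v.1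
      _ = ENNReal.ofReal R * length (annulusMetric Q p R) γ := by
          rw [ENNReal.tsum_mul_left, length]
  rw [← ENNReal.mul_le_mul_iff_right (a := ENNReal.ofReal R) (by simpa using hR)
    ENNReal.ofReal_ne_top, mul_one]
  exact width_le

end AnnulusMetric

theorem DiskPattern.LocallyFiniteIn.finite_inter_closedBall {Q : DiskPattern V}
    (hQ : Q.LocallyFiniteIn univ) (p : ℂ) (R : ℝ) :
    {v | ((Q.disk v).toSet ∩ Metric.closedBall p R).Nonempty}.Finite :=
  hQ.2 _ (subset_univ _) (isCompact_closedBall p R)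

section LocallyFinite

variable {G : SimpleGraph V} {Q : DiskPattern V}

theorem PlaneDisk.isPreconnected (D : PlaneDisk) : IsPreconnected D.toSet :=
  (convex_closedBall _ _).isPreconnected

theorem DiskPattern.LocallyFiniteIn.admissible_annulusMetric [Countable V]
    (hQ : Q.LocallyFiniteIn univ) (hG : G ≤ Q.contactGraph) {p : ℂ} {R : ℝ} (hR : 0 < R) {v₀ : V}
    (hv₀ : (Q.disk v₀).toSet ⊆ Metric.ball p R) :
    Admissible (curvesToInfinity G {v₀}) (annulusMetric Q p R) := by
  rintro _ ⟨q, rfl, hadj, hinf, rfl⟩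
  refine one_le_length_annulusMetric hR fun t ht => exists_range_iff.2 ?_
  refine exists_nonempty_inter_sphere_of_chain (fun k => (Q.disk (q k)).isPreconnected)
    (fun k => (hG (hadj k)).2) ⟨0, ?_⟩ ?_
  · have hc := Metric.mem_closedBall_self (x := (Q.disk (q 0)).center) (Q.disk (q 0)).radius_pos.le
    exact ⟨_, hc, (Metric.ball_subset_closedBall (hv₀ hc)).trans ht.1.le⟩
  · by_contra! hcon
    refine hinf ((hQ.finite_inter_closedBall p t).subset ?_)
    rintro _ ⟨k, rfl⟩
    have hc := Metric.mem_closedBall_self (x := (Q.disk (q k)).center) (Q.disk (q k)).radius_pos.le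
    exact ⟨_, hc, Metric.ball_subset_closedBall (hcon k hc)⟩

theorem DiskPattern.LocallyFiniteIn.velParabolic (hQ : Q.LocallyFiniteIn univ)
    (hQ' : Q.Nonobtuse) (hG : G.Connected) (hGQ : G ≤ Q.contactGraph) : VELParabolic G := by
  have := hQ'.countable
  obtain ⟨v₀⟩ := hG.nonempty
  refine ⟨hG, {v₀}, finite_singleton _, singleton_nonempty _, ENNReal.inv_eq_top.2 ?_⟩
  refine vertexModulus_eq_zero_of_disjoint_metrics (C := 256) (by simp) fun S hS => ?_
  have bounded : Bornology.IsBounded (⋃ v ∈ insert v₀ S, (Q.disk v).toSet) :=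
    (Bornology.isBounded_biUnion (hS.insert v₀)).2 fun v _ => Metric.isBounded_closedBall
  obtain ⟨R, hR, hball⟩ := bounded.subset_ball_lt 0 0
  rw [iUnion₂_subset_iff] at hball
  refine ⟨annulusMetric Q 0 R, area_annulusMetric_le hQ' hR,
    (hQ.finite_inter_closedBall 0 (2 * R)).subset fun v hv => ?_, disjoint_left.2 fun v hv => ?_,
    hQ.admissible_annulusMetric hGQ hR (hball v₀ (mem_insert _ _))⟩
  · exact by_contra fun h => hv (if_neg fun h' => h h'.1)
  · exact Function.notMem_support.2 (if_neg fun h => h.2 (hball v (mem_insert_of_mem _ hv)))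

end LocallyFinite

/-! ### The realization of a triangulation -/

theorem preconnected_induce_of_isPreconnected {X : Type*} [TopologicalSpace X] {H : SimpleGraph V}
    {A : Set X} (hA : IsPreconnected A) {U : V → Set X} (hU : ∀ v, IsOpen (U v))
    (hcover : A ⊆ ⋃ v, U v) (hadj : ∀ ⦃u v⦄, u ≠ v → (A ∩ (U u ∩ U v)).Nonempty → H.Adj u v) :
    (H.induce {v | (A ∩ U v).Nonempty}).Preconnected := by
  intro a b
  by_contra hab
  set K := H.induce {v | (A ∩ U v).Nonempty}
  have cover : A ⊆ (⋃ v : {v | K.Reachable a v}, U v.1) ∪ ⋃ v : {v | ¬ K.Reachable a v}, U v.1 := by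
    intro x hx
    obtain ⟨v, hv⟩ := mem_iUnion.1 (hcover hx)
    by_cases h : K.Reachable a ⟨v, x, hx, hv⟩
    · exact Or.inl (mem_iUnion.2 ⟨⟨_, h⟩, hv⟩)
    · exact Or.inr (mem_iUnion.2 ⟨⟨_, h⟩, hv⟩)
  obtain ⟨x, hxA, hx, hx'⟩ := hA _ _ (isOpen_iUnion fun _ => hU _) (isOpen_iUnion fun _ => hU _)
    cover (a.2.mono fun _ h => ⟨h.1, mem_iUnion.2 ⟨⟨a, .refl a⟩, h.2⟩⟩)
    (b.2.mono fun _ h => ⟨h.1, mem_iUnion.2 ⟨⟨b, hab⟩, h.2⟩⟩)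
  obtain ⟨⟨v, hv⟩, hxv⟩ := mem_iUnion.1 hx
  obtain ⟨⟨w, hw⟩, hxw⟩ := mem_iUnion.1 hx'
  have hvw : (v : V) ≠ w := fun h => hw (Subtype.ext h ▸ hv)
  have adj : K.Adj v w := hadj hvw ⟨x, hxA, hxv, hxw⟩
  exact hw (hv.trans adj.reachable)

section Realization

variable {T : AbstractSimplicialComplex V}

/-- The open star of a vertex. -/
def openStar (T : AbstractSimplicialComplex V) (v : V) : Set (geomRealization T) :=
  {x | 0 < x.1 v}

/-- The closed simplex spanned by `s`, for a face `s`: the points whose carrier lies in `s`. -/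
def closedFace (T : AbstractSimplicialComplex V) (s : Finset V) : Set (geomRealization T) :=
  {x | ∀ v ∉ s, x.1 v = 0}

/-- The open simplex spanned by `s`: the points whose carrier is `s`. -/
def openFace (T : AbstractSimplicialComplex V) (s : Finset V) : Set (geomRealization T) :=
  {x ∈ closedFace T s | ∀ v ∈ s, 0 < x.1 v}

open Classical in
/-- The vertex `v` as a point of the realization. -/
def vertexPoint (T : AbstractSimplicialComplex V) (v : V) : geomRealization T :=
  ⟨Pi.single v 1, fun w => by by_cases h : w = v <;> simp [h], {v},
    T.singleton_mem v, fun w hw => by simp at hw; simp [hw], by simp⟩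

theorem vertexPoint_apply_self (v : V) : (vertexPoint T v).1 v = 1 := by
  simp [vertexPoint]

theorem vertexPoint_apply_of_ne {v w : V} (h : w ≠ v) : (vertexPoint T v).1 w = 0 := by
  simp [vertexPoint, h]

theorem vertexPoint_mem_closedFace {v : V} {s : Finset V} (hv : v ∈ s) :
    vertexPoint T v ∈ closedFace T s := fun _ hw =>
  vertexPoint_apply_of_ne fun h => hw (h ▸ hv)

theorem isOpen_openStar (v : V) : IsOpen (openStar T v) :=
  isOpen_lt continuous_const ((continuous_apply v).comp continuous_subtype_val)

theorem exists_mem_openStar (x : geomRealization T) : ∃ v, x ∈ openStar T v := by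
  obtain ⟨nonneg, s, -, -, hsum⟩ := x.2
  by_contra! h
  rw [Finset.sum_eq_zero fun v _ => le_antisymm (not_lt.1 (h v)) (nonneg v)] at hsum
  exact zero_ne_one hsum

theorem oneSkeleton_adj_of_mem_openStar {x : geomRealization T} {u v : V} (hu : x ∈ openStar T u)
    (hv : x ∈ openStar T v) (huv : u ≠ v) : (oneSkeleton T).Adj u v := by
  obtain ⟨-, s, hs, hsupp, -⟩ := x.2
  exact ⟨huv, s, hs, by_contra fun h => hu.ne' (hsupp u h), by_contra fun h => hv.ne' (hsupp v h)⟩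

theorem preconnected_induce_oneSkeleton {A : Set (geomRealization T)} (hA : IsPreconnected A)
    {U : V → Set (geomRealization T)} (hU : ∀ v, IsOpen (U v)) (hstar : ∀ v, U v ⊆ openStar T v)
    (hcover : A ⊆ ⋃ v, U v) : ((oneSkeleton T).induce {v | (A ∩ U v).Nonempty}).Preconnected :=
  preconnected_induce_of_isPreconnected hA hU hcover fun u v huv ⟨_, _, hxu, hxv⟩ =>
    oneSkeleton_adj_of_mem_openStar (hstar u hxu) (hstar v hxv) huv

theorem oneSkeleton_connected [ConnectedSpace (geomRealization T)] :
    (oneSkeleton T).Connected := by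
  obtain ⟨x⟩ := (inferInstance : Nonempty (geomRealization T))
  have : Nonempty V := ⟨(exists_mem_openStar x).choose⟩
  have induced := preconnected_induce_oneSkeleton (T := T) isPreconnected_univ isOpen_openStar
    (fun _ => Subset.rfl) fun x _ => mem_iUnion.2 (exists_mem_openStar x)
  have hmem (v : V) : (univ ∩ openStar T v).Nonempty :=
    ⟨vertexPoint T v, trivial, by simp [openStar, vertexPoint_apply_self]⟩
  exact ⟨fun u v => (induced ⟨u, hmem u⟩ ⟨v, hmem v⟩).map (SimpleGraph.Embedding.induce _).toHom⟩

theorem sum_eq_one_of_mem_closedFace {x : geomRealization T} {s : Finset V}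
    (hx : x ∈ closedFace T s) : ∑ v ∈ s, x.1 v = 1 := by
  classical
  obtain ⟨-, t, -, ht, hsum⟩ := x.2
  rw [← hsum, Finset.sum_subset (Finset.subset_union_left (s₂ := t)) fun v _ h => hx v h,
    Finset.sum_subset (Finset.subset_union_right (s₁ := s)) fun v _ h => ht v h]

theorem exists_mem_openFace (x : geomRealization T) : ∃ s ∈ T.faces, x ∈ openFace T s := by
  classical
  obtain ⟨nonneg, s, hs, hsupp, -⟩ := x.2
  obtain ⟨v, hv⟩ := exists_mem_openStar x
  refine ⟨{v ∈ s | 0 < x.1 v}, (T.isRelLowerSet_faces hs).2 (Finset.filter_subset _ _)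
    ⟨v, Finset.mem_filter.2 ⟨by_contra fun h => hv.ne' (hsupp v h), hv⟩⟩, fun v hv => ?_,
    fun v hv => (Finset.mem_filter.1 hv).2⟩
  by_cases h : v ∈ s
  · exact le_antisymm (not_lt.1 fun h' => hv (Finset.mem_filter.2 ⟨h, h'⟩)) (nonneg v)
  · exact hsupp v h

theorem subset_of_mem_openFace_of_mem_closedFace {x : geomRealization T} {s t : Finset V}
    (hs : x ∈ openFace T s) (ht : x ∈ closedFace T t) : s ⊆ t :=
  fun v hv => by_contra fun h => (hs.2 v hv).ne' (ht v h)

theorem exists_mem_closedFace_eq_lineMap {s : Finset V} (hs : s ∈ T.faces)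
    {x y : geomRealization T} (hx : x ∈ closedFace T s) (hy : y ∈ closedFace T s) {t : ℝ}
    (ht : t ∈ Icc (0 : ℝ) 1) : ∃ z ∈ closedFace T s, z.1 = AffineMap.lineMap x.1 y.1 t := by
  have coord (v : V) : AffineMap.lineMap x.1 y.1 t v = (1 - t) * x.1 v + t * y.1 v := by
    simp [AffineMap.lineMap_apply_module]
  have support : ∀ v ∉ s, AffineMap.lineMap x.1 y.1 t v = 0 := fun v hv => by
    rw [coord, hx v hv, hy v hv, mul_zero, mul_zero, add_zero]
  refine ⟨⟨AffineMap.lineMap x.1 y.1 t, fun v => ?_, s, hs, support, ?_⟩, support, rfl⟩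
  · rw [coord]
    exact add_nonneg (mul_nonneg (sub_nonneg.2 ht.2) (x.2.1 v)) (mul_nonneg ht.1 (y.2.1 v))
  · simp only [coord, Finset.sum_add_distrib, ← Finset.mul_sum, sum_eq_one_of_mem_closedFace hx,
      sum_eq_one_of_mem_closedFace hy]
    ring

theorem smul_notMem_geomRealization (x : geomRealization T) {c : ℝ} (hc : c ≠ 1) :
    c • x.1 ∉ geomRealization T := by
  intro h
  obtain ⟨s, -, hx, -⟩ := exists_mem_openFace x
  have hsum := sum_eq_one_of_mem_closedFace (x := ⟨c • x.1, h⟩) (s := s) fun v hv => by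
    simp [hx v hv]
  simp only [Pi.smul_apply, smul_eq_mul, ← Finset.mul_sum, sum_eq_one_of_mem_closedFace hx,
    mul_one] at hsum
  exact hc hsum

theorem tendsto_lineMap_vertexPoint_cofinite (T : AbstractSimplicialComplex V) (x : V → ℝ) (t : ℝ) :
    Tendsto (fun w => AffineMap.lineMap x (vertexPoint T w).1 t) cofinite (𝓝 ((1 - t) • x)) := by
  refine tendsto_pi_nhds.2 fun u => tendsto_const_nhds.congr' ?_
  filter_upwards [(finite_singleton u).compl_mem_cofinite] with w hw
  simp [AffineMap.lineMap_apply_module, vertexPoint_apply_of_ne (T := T) (Ne.symm hw)]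

theorem pair_mem_faces [DecidableEq V] {u v : V} (h : (oneSkeleton T).Adj u v) :
    {u, v} ∈ T.faces := by
  obtain ⟨-, s, hs, hu, hv⟩ := h
  exact (T.isRelLowerSet_faces hs).2 (by simp [Finset.insert_subset_iff, hu, hv])
    (Finset.insert_nonempty _ _)

/- If `v` had infinitely many neighbors `w`, the points at a fixed small distance from `v` on the
edges `[v, w]` would accumulate only at a point of total mass less than one. -/
theorem finite_setOf_adj [LocallyCompactSpace (geomRealization T)] (v : V) :
    {w | (oneSkeleton T).Adj v w}.Finite := by
  classical
  obtain ⟨K, hK, hKv⟩ := exists_compact_mem_nhds (vertexPoint T v)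
  obtain ⟨N, hN, hNK⟩ := (mem_nhds_subtype _ _ _).1 hKv
  have shrink : Tendsto (fun t : ℝ => (1 - t) • (vertexPoint T v).1) (𝓝[>] 0)
      (𝓝 (vertexPoint T v).1) := by
    have : Continuous fun t : ℝ => (1 - t) • (vertexPoint T v).1 := by fun_prop
    simpa using (this.tendsto 0).mono_left nhdsWithin_le_nhds
  obtain ⟨t, htN, ht⟩ := ((shrink.eventually (eventually_mem_nhds_iff.2 hN)).and
    (Ioo_mem_nhdsGT (one_pos : (0 : ℝ) < 1))).exists
  by_contra hinf
  have frequently_mem : ∃ᶠ w in cofinite, AffineMap.lineMap (vertexPoint T v).1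
      (vertexPoint T w).1 t ∈ (Subtype.val '' K : Set (V → ℝ)) := by
    refine ((frequently_cofinite_iff_infinite.2 hinf).and_eventually
      ((tendsto_lineMap_vertexPoint_cofinite T _ t).eventually htN)).mono fun w ⟨hw, hwN⟩ => ?_
    obtain ⟨z, -, hz⟩ := exists_mem_closedFace_eq_lineMap (pair_mem_faces hw)
      (vertexPoint_mem_closedFace (Finset.mem_insert_self v {w}))
      (vertexPoint_mem_closedFace (Finset.mem_insert_of_mem (Finset.mem_singleton_self w)))
      (Ioo_subset_Icc_self ht)
    exact ⟨z, hNK (mem_preimage.2 (hz ▸ hwN)), hz⟩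
  obtain ⟨x, -, hx⟩ := (hK.image continuous_subtype_val).isClosed.mem_of_frequently_of_tendsto
    frequently_mem (tendsto_lineMap_vertexPoint_cofinite T _ t)
  exact smul_notMem_geomRealization (vertexPoint T v) (by linarith [ht.1] : 1 - t < 1).ne
    (hx ▸ x.2)

theorem IsOpenDiskTriangulation.connectedSpace (hT : IsOpenDiskTriangulation T) :
    ConnectedSpace (geomRealization T) := by
  obtain ⟨e⟩ := hT.2
  have : ConnectedSpace (Metric.ball (0 : ℂ) 1) := isConnected_iff_connectedSpace.1
    ((convex_ball (0 : ℂ) 1).isConnected (Metric.nonempty_ball.2 one_pos))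
  exact e.symm.surjective.connectedSpace e.symm.continuous

theorem IsOpenDiskTriangulation.locallyCompactSpace (hT : IsOpenDiskTriangulation T) :
    LocallyCompactSpace (geomRealization T) := by
  obtain ⟨e⟩ := hT.2
  have : LocallyCompactSpace (Metric.ball (0 : ℂ) 1) := Metric.isOpen_ball.locallyCompactSpace
  exact e.isClosedEmbedding.locallyCompactSpace

end Realization

/-! ### Invariance of domain in the plane -/

theorem exists_continuous_log {A : Type*} [TopologicalSpace A] [SimplyConnectedSpace A]
    [LocallyPathConnectedSpace A] {f : A → ℂ} (hf : Continuous f) (h0 : ∀ a, f a ≠ 0) :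
    ∃ g : A → ℂ, Continuous g ∧ ∀ a, Complex.exp (g a) = f a := by
  obtain ⟨a₀⟩ : Nonempty A := inferInstance
  obtain ⟨g, ⟨-, hg⟩, -⟩ := Complex.isCoveringMapOn_exp.existsUnique_continuousMap_lifts
    ⟨f, hf⟩ (a₀ := a₀) (Complex.exp_log (h0 a₀)) h0
  exact ⟨g, g.continuous, fun a => congrFun hg a⟩

theorem exists_exp_ne_sub_center {p : ℂ} {r : ℝ} (hr : 0 < r) {g : Metric.sphere p r → ℂ}
    (hg : Continuous g) : ∃ z : Metric.sphere p r, Complex.exp (g z) ≠ z - p := by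
  by_contra! h
  set γ : ℝ → Metric.sphere p r := fun θ => ⟨circleMap p r θ, circleMap_mem_sphere p hr.le θ⟩
  have hγ : Continuous γ := (continuous_circleMap p r).subtype_mk _
  have exp_eq (θ : ℝ) : Complex.exp (g (γ θ) - θ * Complex.I) = r := by
    rw [Complex.exp_sub, h, circleMap_sub_center, circleMap_zero, mul_div_assoc,
      div_self (Complex.exp_ne_zero _), mul_one]
  have constant := Complex.isCoveringMap_exp.const_of_comp
    ((hg.comp hγ).sub (by fun_prop : Continuous fun θ : ℝ => (θ : ℂ) * Complex.I))
    (fun θ θ' => Subtype.ext ((exp_eq θ).trans (exp_eq θ').symm)) 0 (2 * Real.pi)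
  have closed : γ (2 * Real.pi) = γ 0 :=
    Subtype.ext (by simpa using periodic_circleMap p r 0)
  simp only [Pi.sub_apply, Function.comp_apply, closed, Complex.ofReal_zero, zero_mul, sub_zero]
    at constant
  refine Complex.two_pi_I_ne_zero (sub_eq_self (a := g (γ 0)) |>.1 ?_)
  simpa using constant.symm

theorem exists_eq_center_of_dist_lt {f : ℂ → ℂ} {x : ℂ} {r : ℝ} (hr : 0 < r)
    (hf : ContinuousOn f (Metric.closedBall x r))
    (h : ∀ z ∈ Metric.sphere x r, dist (f z) z < r) :
    ∃ z ∈ Metric.closedBall x r, f z = x := by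
  by_contra! hne
  have convex := convex_closedBall x r
  have : ContractibleSpace (Metric.closedBall x r) :=
    convex.contractibleSpace (Metric.nonempty_closedBall.2 hr.le)
  have : LocallyPathConnectedSpace (Metric.closedBall x r) := convex.locallyPathConnectedSpace
  obtain ⟨g, hg, exp_g⟩ := exists_continuous_log
    (hf.domRestrict.sub continuous_const) fun a => sub_ne_zero.2 (hne a a.2)
  have ne_center (z : Metric.sphere x r) : z.1 - x ≠ 0 :=
    norm_pos_iff.1 ((mem_sphere_iff_norm.1 z.2).symm ▸ hr)
  have quotient_mem (z : Metric.sphere x r) : (f z - x) / (z - x) ∈ Complex.slitPlane := by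
    have : (f z - x) / (z - x) = 1 + (f z - z) / (z - x) := by
      field_simp [ne_center z]
      ring
    rw [this]
    refine Complex.mem_slitPlane_of_norm_lt_one ?_
    rw [norm_div, mem_sphere_iff_norm.1 z.2, div_lt_one hr, ← dist_eq_norm]
    exact h z z.2
  have hfs : Continuous fun z : Metric.sphere x r => f z :=
    (hf.mono Metric.sphere_subset_closedBall).domRestrict
  set ι : Metric.sphere x r → Metric.closedBall x r := inclusion Metric.sphere_subset_closedBall
  obtain ⟨z, hz⟩ := exists_exp_ne_sub_center hr
    (g := fun z => g (ι z) - Complex.log ((f z - x) / (z - x)))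
    ((hg.comp (continuous_inclusion _)).sub (((hfs.sub continuous_const).div
      (continuous_subtype_val.sub continuous_const) ne_center).clog quotient_mem))
  have hfz : f z - x ≠ 0 := sub_ne_zero.2 (hne z (Metric.sphere_subset_closedBall z.2))
  refine hz ?_
  rw [Complex.exp_sub, exp_g, Complex.exp_log (div_ne_zero hfz (ne_center z))]
  exact div_div_cancel₀ hfz

theorem exists_leftInvOn_of_isCompact {f : ℂ → ℂ} {K : Set ℂ} (hK : IsCompact K)
    (hf : ContinuousOn f K) (hinj : InjOn f K) : ∃ G : C(ℂ, ℂ), LeftInvOn G f K := by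
  have : CompactSpace K := isCompact_iff_compactSpace.1 hK
  obtain ⟨G, hG⟩ := ContinuousMap.exists_extension' (e := K.domRestrict f)
    (hf.domRestrict.isClosedEmbedding (injOn_iff_injective.1 hinj))
    ⟨Subtype.val, continuous_subtype_val⟩
  exact ⟨G, fun z hz => congrFun hG ⟨z, hz⟩⟩

section PushOff

variable {E : Type*} [NormedAddCommGroup E] [NormedSpace ℝ E]

/-- The radial map of the complement of `c` that moves the points at distance less than `ε` from
`c` to the sphere of radius `ε`, and fixes all other points. -/
def pushOff (c : E) (ε : ℝ) (y : E) : E := c + max 1 (ε / ‖y - c‖) • (y - c)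

theorem continuousOn_pushOff (c : E) (ε : ℝ) : ContinuousOn (pushOff c ε) {c}ᶜ :=
  continuousOn_const.add ((continuousOn_const.sup (continuousOn_const.div (by fun_prop)
    fun _ hy => norm_ne_zero_iff.2 (sub_ne_zero.2 hy))).smul (by fun_prop))

theorem pushOff_of_le_dist {c y : E} {ε : ℝ} (h : ε ≤ dist y c) : pushOff c ε y = y := by
  rw [pushOff, max_eq_left (div_le_one_of_le₀ (dist_eq_norm y c ▸ h) (norm_nonneg _)), one_smul,
    add_sub_cancel]

theorem pushOff_mem_sphere {c y : E} {ε : ℝ} (hy : y ≠ c) (h : dist y c ≤ ε) :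
    pushOff c ε y ∈ Metric.sphere c ε := by
  have hpos : 0 < ‖y - c‖ := norm_pos_iff.2 (sub_ne_zero.2 hy)
  rw [dist_eq_norm] at h
  rw [pushOff, mem_sphere_iff_norm, add_sub_cancel_left, max_eq_right ((one_le_div hpos).2 h),
    norm_smul, Real.norm_of_nonneg (div_nonneg (hpos.le.trans h) hpos.le),
    div_mul_cancel₀ _ hpos.ne']

open MeasureTheory in
theorem exists_approx_forall_ne [FiniteDimensional ℝ E] [MeasurableSpace E] [BorelSpace E]
    {G : E → E} (hG : Continuous G) {m : ℝ} (hm : 0 < m) (μ : Measure E) [μ.IsAddHaarMeasure]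
    {N : Set E} (hN : μ N = 0) (x : E) :
    ∃ H : E → E, Continuous H ∧ (∀ y, dist (H y) (G y) < m) ∧ ∀ y ∈ N, H y ≠ x := by
  obtain ⟨F, hF, hFG, -⟩ := hG.exists_contDiff_approx 1 (ε := fun _ => m / 2)
    continuous_const fun _ => half_pos hm
  have null_image : μ (F '' N) = 0 := addHaar_image_eq_zero_of_differentiableOn_of_addHaar_eq_zero μ
    (hF.differentiable one_ne_zero).differentiableOn hN
  obtain ⟨w, hw, hwF⟩ : ∃ w ∈ Metric.ball x (m / 2), w ∉ F '' N := by
    by_contra! hsub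
    exact (Metric.measure_ball_pos μ x (half_pos hm)).ne' (measure_mono_null hsub null_image)
  refine ⟨fun y => F y - (w - x), hF.continuous.sub continuous_const, fun y => ?_,
    fun y hy h => hwF ⟨y, hy, ?_⟩⟩
  · have h₁ := hFG y
    rw [Metric.mem_ball, dist_eq_norm] at hw
    rw [dist_eq_norm] at h₁ ⊢
    have : F y - (w - x) - G y = (F y - G y) - (w - x) := by abel
    rw [this]
    linarith [norm_sub_le (F y - G y) (w - x)]
  · simpa [sub_sub_eq_add_sub, sub_eq_iff_eq_add, add_comm x w] using h

end PushOff

/- If `c` were not in the image, push the image off the disk of radius `ε` around `c` and compose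
with a left inverse of `f`, perturbed so as not to take the value `x` on the circle of radius `ε`:
a map that is close to the identity on the boundary but omits the value `x`. -/
theorem mem_image_closedBall_of_dist_lt {f : ℂ → ℂ} {x c : ℂ} {r ε : ℝ} (hr : 0 < r)
    (hf : ContinuousOn f (Metric.closedBall x r)) (hinj : InjOn f (Metric.closedBall x r))
    (hx : dist (f x) c < ε) (hsphere : ∀ z ∈ Metric.sphere x r, ε ≤ dist (f z) c) :
    c ∈ f '' Metric.closedBall x r := by
  by_contra hc
  set B := Metric.closedBall x r
  have f_ne : MapsTo f B {c}ᶜ := fun z hz h => hc ⟨z, hz, h⟩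
  have hB : IsCompact B := isCompact_closedBall x r
  obtain ⟨G, hG⟩ := exists_leftInvOn_of_isCompact hB hf hinj
  have far_compact : IsCompact (G '' (f '' B ∩ {y | ε ≤ dist y c})) :=
    ((hB.image_of_continuousOn hf).inter_right
      (isClosed_le continuous_const (by fun_prop))).image G.continuous
  have far_ne : x ∉ G '' (f '' B ∩ {y | ε ≤ dist y c}) := by
    rintro ⟨_, ⟨⟨z, hz, rfl⟩, hzc⟩, hzx⟩
    rw [hG hz] at hzx
    exact hx.not_ge (hzx ▸ hzc)
  obtain ⟨m, hm, hball⟩ := Metric.isOpen_iff.1 far_compact.isClosed.isOpen_compl x far_ne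
  obtain ⟨H, hH, hHG, hHx⟩ := exists_approx_forall_ne G.continuous (lt_min hm hr)
    MeasureTheory.volume (MeasureTheory.Measure.addHaar_sphere _ c ε) x
  obtain ⟨z, hz, hzx⟩ := exists_eq_center_of_dist_lt (f := H ∘ pushOff c ε ∘ f) hr
    (hH.comp_continuousOn ((continuousOn_pushOff c ε).comp hf f_ne)) fun z hz => by
      have := hHG (f z)
      rw [hG (Metric.sphere_subset_closedBall hz)] at this
      simpa only [Function.comp_apply, pushOff_of_le_dist (hsphere z hz)] using
        this.trans_le (min_le_right _ _)
  rcases le_total (dist (f z) c) ε with h | h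
  · exact hHx _ (pushOff_mem_sphere (f_ne hz) h) hzx
  · rw [Function.comp_apply, Function.comp_apply, pushOff_of_le_dist h] at hzx
    refine hball ?_ ⟨f z, ⟨⟨z, hz, rfl⟩, h⟩, rfl⟩
    rw [Metric.mem_ball, dist_comm, ← hzx]
    exact (hHG (f z)).trans_le (min_le_left _ _)

theorem image_closedBall_mem_nhds {f : ℂ → ℂ} {x : ℂ} {r : ℝ} (hr : 0 < r)
    (hf : ContinuousOn f (Metric.closedBall x r)) (hinj : InjOn f (Metric.closedBall x r)) :
    f '' Metric.closedBall x r ∈ 𝓝 (f x) := by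
  have sphere_closed : IsClosed (f '' Metric.sphere x r) :=
    ((isCompact_sphere x r).image_of_continuousOn
      (hf.mono Metric.sphere_subset_closedBall)).isClosed
  have hx : f x ∉ f '' Metric.sphere x r := by
    rintro ⟨z, hz, hzx⟩
    have := hinj (Metric.sphere_subset_closedBall hz) (Metric.mem_closedBall_self hr.le) hzx
    rw [this, Metric.mem_sphere, dist_self] at hz
    exact hr.ne hz
  obtain ⟨δ, hδ, hball⟩ := Metric.isOpen_iff.1 sphere_closed.isOpen_compl (f x) hx
  refine mem_of_superset (Metric.ball_mem_nhds _ (half_pos hδ)) fun c hc => ?_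
  rw [Metric.mem_ball, dist_comm] at hc
  refine mem_image_closedBall_of_dist_lt hr hf hinj hc fun z hz => ?_
  have : ¬ dist (f z) (f x) < δ := fun h => hball h ⟨z, hz, rfl⟩
  linarith [dist_triangle_right (f z) (f x) c]

theorem isOpenMap_of_isLocallyInjective {U : Set ℂ} (hU : IsOpen U) {f : U → ℂ}
    (hf : Continuous f) (hinj : IsLocallyInjective f) : IsOpenMap f := by
  refine IsOpenMap.of_nhds_le fun x s hs => ?_
  obtain ⟨W, hW, hxW, hWinj⟩ := hinj x
  have hN : Subtype.val '' (f ⁻¹' s ∩ W) ∈ 𝓝 (x : ℂ) :=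
    hU.isOpenEmbedding_subtypeVal.image_mem_nhds.2 (inter_mem hs (hW.mem_nhds hxW))
  obtain ⟨r, hr, hball⟩ := Metric.nhds_basis_closedBall.mem_iff.1 hN
  set F : ℂ → ℂ := Function.extend Subtype.val f 0
  have hF (z : U) : F z = f z := Subtype.val_injective.extend_apply f 0 z
  have continuousOn : ContinuousOn F (Metric.closedBall x r) := by
    refine ContinuousOn.mono (s := U) ?_ fun z hz => ?_
    · rw [continuousOn_iff_continuous_domRestrict]
      exact hf.congr fun z => (hF z).symm
    · obtain ⟨y, -, rfl⟩ := hball hz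
      exact y.2
  have injOn : InjOn F (Metric.closedBall x r) := by
    intro z hz w hw hzw
    obtain ⟨z, ⟨-, hzW⟩, rfl⟩ := hball hz
    obtain ⟨w, ⟨-, hwW⟩, rfl⟩ := hball hw
    rw [hF, hF] at hzw
    rw [hWinj hzW hwW hzw]
  rw [← hF x]
  refine mem_of_superset (image_closedBall_mem_nhds hr continuousOn injOn) ?_
  rintro _ ⟨z, hz, rfl⟩
  obtain ⟨y, ⟨hy, -⟩, rfl⟩ := hball hz
  exact (hF y).symm ▸ hy

/-! ### The center map -/

theorem nonempty_inter_frontier {X : Type*} [TopologicalSpace X] {A S : Set X}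
    (hA : IsPreconnected A) (hS : (A ∩ S).Nonempty) (hS' : (A ∩ Sᶜ).Nonempty) :
    (A ∩ frontier S).Nonempty := by
  by_contra h
  obtain ⟨x, -, hx, hx'⟩ := hA (interior S) (interior Sᶜ) isOpen_interior isOpen_interior
    (fun x hx => by
      by_contra hxS
      rw [← compl_frontier_eq_union_interior, notMem_compl_iff] at hxS
      exact h ⟨x, hx, hxS⟩)
    (hS.mono fun x hx => ⟨hx.1, by_contra fun hxS => h ⟨x, hx.1, subset_closure hx.2, hxS⟩⟩)
    (hS'.mono fun x hx => ⟨hx.1, by_contra fun hxS =>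
      h ⟨x, hx.1, frontier_compl S ▸ ⟨subset_closure hx.2, hxS⟩⟩⟩)
  exact interior_subset hx' (interior_subset hx)

section CenterMap

variable {T : AbstractSimplicialComplex V} {Q : DiskPattern V} {s : Finset V}

theorem DiskPattern.centerMap_eq_sum (Q : DiskPattern V) {x : geomRealization T}
    (hx : x ∈ closedFace T s) : Q.centerMap T x = ∑ v ∈ s, x.1 v • (Q.disk v).center := by
  refine finsum_eq_sum_of_support_subset _ fun v hv => ?_
  by_contra h
  exact hv (by simp [hx v h])

theorem DiskPattern.centerMap_vertexPoint (Q : DiskPattern V) (v : V) :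
    Q.centerMap T (vertexPoint T v) = (Q.disk v).center := by
  rw [Q.centerMap_eq_sum (vertexPoint_mem_closedFace (Finset.mem_singleton_self v)),
    Finset.sum_singleton, vertexPoint_apply_self, one_smul]

theorem DiskPattern.centerMap_of_eq_lineMap (Q : DiskPattern V) {x y z : geomRealization T}
    (hx : x ∈ closedFace T s) (hy : y ∈ closedFace T s) {t : ℝ}
    (hz : z.1 = AffineMap.lineMap x.1 y.1 t) :
    Q.centerMap T z = AffineMap.lineMap (Q.centerMap T x) (Q.centerMap T y) t := by
  have coord (v : V) : z.1 v = (1 - t) * x.1 v + t * y.1 v := by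
    simp [hz, AffineMap.lineMap_apply_module]
  have hzs : z ∈ closedFace T s := fun v hv => by rw [coord, hx v hv, hy v hv]; ring
  rw [Q.centerMap_eq_sum hx, Q.centerMap_eq_sum hy, Q.centerMap_eq_sum hzs,
    AffineMap.lineMap_apply_module]
  simp only [coord, add_smul, mul_smul, Finset.sum_add_distrib, Finset.smul_sum]

theorem DiskPattern.continuous_centerMap (Q : DiskPattern V)
    [LocallyCompactSpace (geomRealization T)] : Continuous (Q.centerMap T) := by
  classical
  refine continuous_iff_continuousAt.2 fun x => ?_
  obtain ⟨v, hv⟩ := exists_mem_openStar x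
  set N := insert v (finite_setOf_adj (T := T) v).toFinset
  have star_subset : openStar T v ⊆ closedFace T N := by
    intro y hy w hw
    by_contra h
    have hyw : y ∈ openStar T w := lt_of_le_of_ne (y.2.1 w) (Ne.symm h)
    obtain rfl | hvw := eq_or_ne v w
    · exact hw (Finset.mem_insert_self _ _)
    · exact hw (Finset.mem_insert_of_mem
        ((Finite.mem_toFinset _).2 (oneSkeleton_adj_of_mem_openStar hy hyw hvw)))
  have continuous_sum : Continuous fun y : geomRealization T =>
      ∑ w ∈ N, y.1 w • (Q.disk w).center := continuous_finsetSum _ fun w _ =>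
    ((continuous_apply w).comp continuous_subtype_val).smul continuous_const
  refine continuous_sum.continuousAt.congr ?_
  filter_upwards [(isOpen_openStar v).mem_nhds hv] with y hy
  exact (Q.centerMap_eq_sum (star_subset hy)).symm

theorem DiskPattern.IsImmersed.isOpenMap (himm : Q.IsImmersed T)
    (hT : IsOpenDiskTriangulation T) : IsOpenMap (Q.centerMap T) := by
  have := hT.locallyCompactSpace
  obtain ⟨e⟩ := hT.2
  have locally_injective : IsLocallyInjective (Q.centerMap T ∘ e.symm) := by
    intro x
    obtain ⟨U, hU, hxU, hinj⟩ := himm (e.symm x)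
    exact ⟨e.symm ⁻¹' U, hU.preimage e.symm.continuous, hxU, hinj.comp e.symm.injective.injOn
      (mapsTo_preimage _ _)⟩
  have := (isOpenMap_of_isLocallyInjective Metric.isOpen_ball
    (Q.continuous_centerMap.comp e.symm.continuous) locally_injective).comp e.isOpenMap
  simpa [Function.comp_assoc] using this

/-- The union of the closed faces of `T` that contain the vertex `a`. -/
def closedStar (T : AbstractSimplicialComplex V) (a : V) : Set (geomRealization T) :=
  {x | ∃ s ∈ T.faces, a ∈ s ∧ x ∈ closedFace T s}

theorem DiskPattern.eventually_exists_centerMap_eq_lineMap (Q : DiskPattern V) {a : V}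
    {x : geomRealization T} (hx : x ∈ closedStar T a) {U : Set (geomRealization T)}
    (hU : U ∈ 𝓝 (vertexPoint T a)) : ∀ᶠ t : ℝ in 𝓝[>] 0,
      ∃ z ∈ U, z.1 = AffineMap.lineMap (vertexPoint T a).1 x.1 t ∧
        Q.centerMap T z = AffineMap.lineMap (Q.disk a).center (Q.centerMap T x) t := by
  obtain ⟨s, hs, has, hxs⟩ := hx
  obtain ⟨N, hN, hNU⟩ := (mem_nhds_subtype _ _ _).1 hU
  have tendsto : Tendsto (fun t : ℝ => AffineMap.lineMap (vertexPoint T a).1 x.1 t) (𝓝[>] 0)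
      (𝓝 (vertexPoint T a).1) := by
    have continuous : Continuous fun t : ℝ => AffineMap.lineMap (vertexPoint T a).1 x.1 t :=
      AffineMap.lineMap_continuous
    simpa using (continuous.tendsto 0).mono_left nhdsWithin_le_nhds
  filter_upwards [tendsto.eventually hN, Ioo_mem_nhdsGT (one_pos : (0 : ℝ) < 1)] with t htN ht
  have hav := vertexPoint_mem_closedFace (T := T) has
  obtain ⟨z, -, hz⟩ := exists_mem_closedFace_eq_lineMap hs hav hxs (Ioo_subset_Icc_self ht)
  exact ⟨z, hNU (mem_preimage.2 (hz ▸ htN)), hz,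
    Q.centerMap_vertexPoint (T := T) a ▸ Q.centerMap_of_eq_lineMap hav hxs hz⟩

theorem DiskPattern.IsImmersed.injOn_closedStar (himm : Q.IsImmersed T) (a : V) :
    InjOn (Q.centerMap T) (closedStar T a) := by
  intro x hx y hy hxy
  obtain ⟨U, hU, haU, hinj⟩ := himm (vertexPoint T a)
  have near (z) (hz : z ∈ closedStar T a) :=
    Q.eventually_exists_centerMap_eq_lineMap hz (hU.mem_nhds haU)
  obtain ⟨t, ⟨⟨x', hx', hx't, hx'c⟩, y', hy', hy't, hy'c⟩, ht⟩ :=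
    (((near x hx).and (near y hy)).and self_mem_nhdsWithin).exists
  have shrunk := congrArg Subtype.val (hinj hx' hy' (by rw [hx'c, hy'c, hxy]))
  rw [hx't, hy't] at shrunk
  simp only [AffineMap.lineMap_apply_module, add_right_inj] at shrunk
  exact Subtype.ext (smul_right_injective _ (ne_of_gt ht) shrunk)

/-- The triangle (segment, point) spanned by the centers of the disks of a face. -/
def DiskPattern.hull (Q : DiskPattern V) (s : Finset V) : Set ℂ :=
  convexHull ℝ ((fun v => (Q.disk v).center) '' s)

theorem DiskPattern.hull_pair [DecidableEq V] (Q : DiskPattern V) (a b : V) :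
    Q.hull {a, b} = segment ℝ (Q.disk a).center (Q.disk b).center := by
  rw [DiskPattern.hull, Finset.coe_pair, image_pair, convexHull_pair]

theorem DiskPattern.center_mem_hull (Q : DiskPattern V) {v : V} (hv : v ∈ s) :
    (Q.disk v).center ∈ Q.hull s :=
  subset_convexHull _ _ (mem_image_of_mem _ hv)

theorem DiskPattern.isClosed_hull (Q : DiskPattern V) (s : Finset V) : IsClosed (Q.hull s) :=
  (s.finite_toSet.image _).isClosed_convexHull _

theorem DiskPattern.centerMap_mem_hull (Q : DiskPattern V) {x : geomRealization T}
    (hx : x ∈ closedFace T s) : Q.centerMap T x ∈ Q.hull s := by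
  rw [Q.centerMap_eq_sum hx]
  exact (convex_convexHull ℝ _).sum_mem (fun v _ => x.2.1 v) (sum_eq_one_of_mem_closedFace hx)
    fun v hv => Q.center_mem_hull hv

theorem DiskPattern.image_closedFace (Q : DiskPattern V) (hs : s ∈ T.faces) :
    Q.centerMap T '' closedFace T s = Q.hull s := by
  refine Subset.antisymm (image_subset_iff.2 fun x hx => Q.centerMap_mem_hull hx)
    (convexHull_min ?_ (convex_iff_segment_subset.2 ?_))
  · rintro _ ⟨v, hv, rfl⟩
    exact ⟨vertexPoint T v, vertexPoint_mem_closedFace hv, Q.centerMap_vertexPoint v⟩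
  · rintro _ ⟨x, hx, rfl⟩ _ ⟨y, hy, rfl⟩
    rw [segment_eq_image_lineMap]
    rintro _ ⟨t, ht, rfl⟩
    obtain ⟨z, hz, hzt⟩ := exists_mem_closedFace_eq_lineMap hs hx hy ht
    exact ⟨z, hz, Q.centerMap_of_eq_lineMap hx hy hzt⟩

theorem DiskPattern.exists_mem_segment_of_mem_hull (Q : DiskPattern V) (hs : s.card < 3) {z : ℂ}
    (hz : z ∈ Q.hull s) :
    ∃ a ∈ s, ∃ b ∈ s, z ∈ segment ℝ (Q.disk a).center (Q.disk b).center := by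
  classical
  obtain h | h | h : s.card = 0 ∨ s.card = 1 ∨ s.card = 2 := by omega
  · rw [Finset.card_eq_zero.1 h] at hz
    simp [DiskPattern.hull] at hz
  · obtain ⟨a, rfl⟩ := Finset.card_eq_one.1 h
    exact ⟨a, by simp, a, by simp, Q.hull_pair a a ▸ by simpa using hz⟩
  · obtain ⟨a, b, -, rfl⟩ := Finset.card_eq_two.1 h
    exact ⟨a, by simp, b, by simp, Q.hull_pair a b ▸ hz⟩

theorem isOpen_openFace_of_card_eq_three (hT : IsOpenDiskTriangulation T) (hcard : s.card = 3) :
    IsOpen (openFace T s) := by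
  have : openFace T s = ⋂ v ∈ s, openStar T v := by
    refine Subset.antisymm (fun x hx => mem_iInter₂.2 hx.2) fun x hx => ?_
    have hpos := mem_iInter₂.1 hx
    obtain ⟨t, ht, hxt⟩ := exists_mem_openFace x
    have hst : s ⊆ t := fun v hv => by_contra fun h => (hpos v hv).ne' (hxt.1 v h)
    exact Finset.eq_of_subset_of_card_le hst (hcard ▸ hT.1 t ht) ▸ hxt
  rw [this]
  exact isOpen_biInter_finset fun v _ => isOpen_openStar v

theorem DiskPattern.IsImmersed.centerMap_mem_interior_hull (himm : Q.IsImmersed T)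
    (hT : IsOpenDiskTriangulation T) (hcard : s.card = 3) {x : geomRealization T}
    (hx : x ∈ openFace T s) : Q.centerMap T x ∈ interior (Q.hull s) :=
  mem_interior.2 ⟨_, image_subset_iff.2 fun _ hy => Q.centerMap_mem_hull hy.1,
    himm.isOpenMap hT _ (isOpen_openFace_of_card_eq_three hT hcard), x, hx, rfl⟩

theorem DiskPattern.IsImmersed.exists_mem_segment_inter_segment (himm : Q.IsImmersed T)
    (hT : IsOpenDiskTriangulation T) (hs : s ∈ T.faces) {z y : ℂ} (hz : z ∈ Q.hull s)
    (hy : y ∉ Q.hull s) :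
    ∃ w ∈ segment ℝ z y ∩ Q.hull s, ∃ a ∈ s, ∃ b ∈ s,
      w ∈ segment ℝ (Q.disk a).center (Q.disk b).center := by
  obtain ⟨w, hw, hwf⟩ := nonempty_inter_frontier (convex_segment z y).isPreconnected
    ⟨z, left_mem_segment ℝ z y, hz⟩ ⟨y, right_mem_segment ℝ z y, hy⟩
  rw [(Q.isClosed_hull s).frontier_eq] at hwf
  refine ⟨w, ⟨hw, hwf.1⟩, ?_⟩
  obtain ⟨x, hx, rfl⟩ := (Q.image_closedFace hs).symm ▸ hwf.1
  obtain ⟨t, ht, hxt⟩ := exists_mem_openFace x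
  have hts := subset_of_mem_openFace_of_mem_closedFace hxt hx
  have hcard : t.card < 3 := lt_of_le_of_ne (hT.1 t ht) fun h => by
    obtain rfl := Finset.eq_of_subset_of_card_le hts (h ▸ hT.1 s hs)
    exact hwf.2 (himm.centerMap_mem_interior_hull hT h hxt)
  obtain ⟨a, ha, b, hb, hab⟩ := Q.exists_mem_segment_of_mem_hull hcard (Q.centerMap_mem_hull hxt.1)
  exact ⟨a, hts ha, b, hts hb, hab⟩

end CenterMap

/-! ### The center map of an immersed pattern is injective -/

theorem eq_of_mem_segment_of_mem_segment {E : Type*} [AddCommGroup E] [Module ℝ E] {m d e w : E}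
    (hm : m ∈ segment ℝ d e) (hd : w ∈ segment ℝ m d) (he : w ∈ segment ℝ m e) : w = m := by
  rw [mem_segment_iff_wbtw] at hm hd he
  exact ((wbtw_swap_right_iff ℝ d).1 ⟨hm.trans_right_left he, hd.symm⟩).symm

open MeasureTheory in
theorem addHaar_segment_eq_zero {E : Type*} [NormedAddCommGroup E] [NormedSpace ℝ E]
    [FiniteDimensional ℝ E] [MeasurableSpace E] [BorelSpace E] (μ : Measure E)
    [μ.IsAddHaarMeasure] (hE : 1 < Module.finrank ℝ E) (a b : E) : μ (segment ℝ a b) = 0 := by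
  have line_ne_top : affineSpan ℝ {a, b} ≠ ⊤ := fun h => by
    have := collinear_iff_finrank_le_one.1 (collinear_pair ℝ a b)
    rw [← direction_affineSpan, h, AffineSubspace.direction_top, finrank_top] at this
    omega
  exact measure_mono_null (convexHull_pair (𝕜 := ℝ) a b ▸ convexHull_subset_affineSpan _)
    (μ.addHaar_affineSubspace _ line_ne_top)

theorem injective_of_isOpenMap_of_dense {X Y : Type*} [TopologicalSpace X] [TopologicalSpace Y]
    [T2Space X] {f : X → Y} (hf : IsOpenMap f) {D : Set Y} (hD : Dense D)
    (h : ∀ x y, f x = f y → f x ∈ D → x = y) : Function.Injective f := by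
  intro x y hxy
  by_contra hne
  obtain ⟨U, U', hU, hU', hx, hy, hdisj⟩ := t2_separation hne
  obtain ⟨z, ⟨⟨x', hx', hxz⟩, y', hy', hyz⟩, hz⟩ := hD.inter_open_nonempty _
    ((hf U hU).inter (hf U' hU')) ⟨f x, mem_image_of_mem f hx, hxy ▸ mem_image_of_mem f hy⟩
  exact disjoint_left.1 hdisj hx' (h x' y' (hxz.trans hyz.symm) (hxz ▸ hz) ▸ hy')

section Injective

variable {T : AbstractSimplicialComplex V} {Q : DiskPattern V} {s : Finset V}

theorem DiskPattern.MetricallyRealizes.dist_le_of_mem_face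
    (hQ : Q.MetricallyRealizes (oneSkeleton T)) (hs : s ∈ T.faces) {a b : V} (ha : a ∈ s)
    (hb : b ∈ s) :
    dist (Q.disk a).center (Q.disk b).center ≤ (Q.disk a).radius + (Q.disk b).radius := by
  obtain rfl | h := eq_or_ne a b
  · rw [dist_self]
    linarith [(Q.disk a).radius_pos]
  · exact hQ.dist_le_of_adj ⟨h, s, hs, ha, hb⟩

theorem DiskPattern.MetricallyRealizes.tangency_of_mem_segment_inter
    (hQ : Q.MetricallyRealizes (oneSkeleton T)) (hs : s ∈ T.faces) {a b d e : V} (ha : a ∈ s)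
    (hb : b ∈ s) (hd : d ∉ s) (he : e ∉ s) (hde : (oneSkeleton T).Adj d e) {z : ℂ}
    (hz : z ∈ segment ℝ (Q.disk a).center (Q.disk b).center)
    (hz' : z ∈ segment ℝ (Q.disk d).center (Q.disk e).center) :
    z = AffineMap.lineMap (Q.disk d).center (Q.disk e).center
      ((Q.disk d).radius / ((Q.disk d).radius + (Q.disk e).radius)) ∧ (oneSkeleton T).Adj a d := by
  have nonobtuse {v w : V} (hv : v ∈ s) (hw : w ∉ s) :=
    hQ.nonobtuse v w (ne_of_mem_of_not_mem hv hw)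
  obtain ⟨hz, had⟩ := HePattern.tangency_of_mem_segment_inter (Q.disk a).radius_pos
    (Q.disk b).radius_pos (Q.disk d).radius_pos (Q.disk e).radius_pos
    (hQ.dist_le_of_mem_face hs ha hb) (hQ.dist_le_of_adj hde) (nonobtuse ha hd) (nonobtuse ha he)
    (nonobtuse hb hd) (nonobtuse hb he) hz hz'
  exact ⟨hz, hQ.adj_of_dist_sq_eq (ne_of_mem_of_not_mem ha hd) had⟩

theorem DiskPattern.IsImmersed.not_adj_of_center_mem_hull (himm : Q.IsImmersed T)
    (hs : s ∈ T.faces) {a d : V} (ha : a ∈ s) (hd : d ∉ s) (hmem : (Q.disk d).center ∈ Q.hull s) :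
    ¬ (oneSkeleton T).Adj a d := by
  classical
  intro hadj
  obtain ⟨x, hx, hxd⟩ := Q.image_closedFace hs ▸ hmem
  have hdstar : vertexPoint T d ∈ closedStar T a :=
    ⟨_, pair_mem_faces hadj, by simp, vertexPoint_mem_closedFace (by simp)⟩
  obtain rfl := himm.injOn_closedStar a ⟨s, hs, ha, hx⟩ hdstar
    (hxd.trans (Q.centerMap_vertexPoint d).symm)
  exact one_ne_zero ((vertexPoint_apply_self d).symm.trans (hx d hd))

/- Otherwise some edge leaves the triangle from a vertex whose center it contains. It crosses a
side of the triangle, so one of the corners is a neighbor of that vertex, and the center map is not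
injective on the star of this corner. -/
theorem DiskPattern.MetricallyRealizes.center_notMem_hull
    (hQ : Q.MetricallyRealizes (oneSkeleton T)) (himm : Q.IsImmersed T)
    (hT : IsOpenDiskTriangulation T) (hs : s ∈ T.faces) {d : V} (hd : d ∉ s) :
    (Q.disk d).center ∉ Q.hull s := by
  intro hmem
  have := hT.connectedSpace
  obtain ⟨u₀, hu₀⟩ := (T.isRelLowerSet_faces hs).1
  obtain ⟨p⟩ := oneSkeleton_connected (T := T) |>.preconnected d u₀
  obtain ⟨⟨⟨v, u⟩, hvu⟩, -, ⟨hvs, hv⟩, hu⟩ :=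
    p.exists_boundary_dart {v | v ∉ s ∧ (Q.disk v).center ∈ Q.hull s} ⟨hd, hmem⟩
      fun h => h.1 hu₀
  by_cases hus : u ∈ s
  · exact himm.not_adj_of_center_mem_hull hs hus hvs hv hvu.symm
  · obtain ⟨w, ⟨hw, -⟩, a, ha, b, hb, hab⟩ :=
      himm.exists_mem_segment_inter_segment hT hs hv fun h => hu ⟨hus, h⟩
    exact himm.not_adj_of_center_mem_hull hs ha hvs hv
      (hQ.tangency_of_mem_segment_inter hs ha hb hvs hus hvu hab hw).2

/- Such an edge would leave the triangle on both sides of an interior point, each time through the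
point of tangency of its two disks; so this point would be the interior point itself. -/
theorem DiskPattern.MetricallyRealizes.centerMap_notMem_segment
    (hQ : Q.MetricallyRealizes (oneSkeleton T)) (himm : Q.IsImmersed T)
    (hT : IsOpenDiskTriangulation T) (hs : s ∈ T.faces) (hcard : s.card = 3)
    {x : geomRealization T} (hx : x ∈ openFace T s) {d e : V} (hd : d ∉ s) (he : e ∉ s)
    (hde : (oneSkeleton T).Adj d e) :
    Q.centerMap T x ∉ segment ℝ (Q.disk d).center (Q.disk e).center := by
  classical
  intro hm
  have hxs := Q.centerMap_mem_hull hx.1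
  obtain ⟨w, ⟨hw, -⟩, a, ha, b, hb, hab⟩ :=
    himm.exists_mem_segment_inter_segment hT hs hxs (hQ.center_notMem_hull himm hT hs hd)
  obtain ⟨w', ⟨hw', -⟩, a', ha', b', hb', hab'⟩ :=
    himm.exists_mem_segment_inter_segment hT hs hxs (hQ.center_notMem_hull himm hT hs he)
  have convex := convex_segment (𝕜 := ℝ) (Q.disk d).center (Q.disk e).center
  have tangency := (hQ.tangency_of_mem_segment_inter hs ha hb hd he hde hab
    (convex.segment_subset hm (left_mem_segment _ _ _) hw)).1
  have tangency' := (hQ.tangency_of_mem_segment_inter hs ha' hb' hd he hde hab'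
    (convex.segment_subset hm (right_mem_segment _ _ _) hw')).1
  obtain rfl : w = Q.centerMap T x :=
    eq_of_mem_segment_of_mem_segment hm hw (tangency.trans tangency'.symm ▸ hw')
  have hsub : ({a, b} : Finset V) ⊆ s := by simp [Finset.insert_subset_iff, ha, hb]
  have hface : ({a, b} : Finset V) ∈ T.faces :=
    (T.isRelLowerSet_faces hs).2 hsub (Finset.insert_nonempty _ _)
  obtain ⟨y, hy, hyx⟩ := Q.image_closedFace hface ▸ Q.hull_pair a b ▸ hab
  obtain rfl := himm.injOn_closedStar a ⟨_, hface, by simp, hy⟩ ⟨s, hs, ha, hx.1⟩ hyx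
  have := Finset.card_le_card (subset_of_mem_openFace_of_mem_closedFace hx hy)
  have := Finset.card_le_two (a := a) (b := b)
  omega

/- The segment from the common value to a corner of `t` leaves the triangle of `s` through one of
its sides, at the image of another point of the open face `t`. -/
theorem DiskPattern.MetricallyRealizes.centerMap_ne_of_disjoint
    (hQ : Q.MetricallyRealizes (oneSkeleton T)) (himm : Q.IsImmersed T)
    (hT : IsOpenDiskTriangulation T) {t : Finset V} (hs : s ∈ T.faces) (ht : t ∈ T.faces)
    (hcard : t.card = 3) (hst : Disjoint s t) {x y : geomRealization T} (hx : x ∈ closedFace T s)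
    (hy : y ∈ openFace T t) : Q.centerMap T x ≠ Q.centerMap T y := by
  intro hxy
  obtain ⟨d, hd⟩ := (T.isRelLowerSet_faces ht).1
  have hds := hQ.center_notMem_hull himm hT hs (Finset.disjoint_right.1 hst hd)
  obtain ⟨w, ⟨hw, hws⟩, a, ha, b, hb, hab⟩ :=
    himm.exists_mem_segment_inter_segment hT hs (Q.centerMap_mem_hull hx) hds
  rw [segment_eq_image_lineMap, hxy] at hw
  obtain ⟨τ, hτ, rfl⟩ := hw
  have hτ1 : τ < 1 := lt_of_le_of_ne hτ.2 fun h => hds (by simpa [h] using hws)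
  have hdt := vertexPoint_mem_closedFace (T := T) hd
  obtain ⟨y', hy', hy'τ⟩ := exists_mem_closedFace_eq_lineMap ht hy.1 hdt hτ
  rw [← Q.centerMap_vertexPoint (T := T) d, ← Q.centerMap_of_eq_lineMap hy.1 hdt hy'τ] at hab
  have hy'pos : y' ∈ openFace T t := by
    refine ⟨hy', fun v hv => ?_⟩
    rw [hy'τ, AffineMap.lineMap_apply_module]
    exact add_pos_of_pos_of_nonneg (mul_pos (sub_pos.2 hτ1) (hy.2 v hv))
      (mul_nonneg hτ.1 ((vertexPoint T d).2.1 v))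
  have hat := Finset.disjoint_left.1 hst ha
  obtain rfl | hne := eq_or_ne a b
  · rw [segment_same, mem_singleton_iff] at hab
    exact hQ.center_notMem_hull himm hT ht hat (hab ▸ Q.centerMap_mem_hull hy')
  · exact hQ.centerMap_notMem_segment himm hT ht hcard hy'pos hat
      (Finset.disjoint_left.1 hst hb) ⟨hne, s, hs, ha, hb⟩ hab

open MeasureTheory in
theorem DiskPattern.dense_compl_iUnion_segment [Countable V] (Q : DiskPattern V) :
    Dense (⋃ p : V × V, segment ℝ (Q.disk p.1).center (Q.disk p.2).center)ᶜ := by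
  refine Measure.dense_of_ae (μ := volume) (compl_mem_ae_iff.2 ?_)
  exact measure_iUnion_null fun p =>
    addHaar_segment_eq_zero volume (by simp [Complex.finrank_real_complex]) _ _

theorem DiskPattern.MetricallyRealizes.centerMap_injective
    (hQ : Q.MetricallyRealizes (oneSkeleton T)) (himm : Q.IsImmersed T)
    (hT : IsOpenDiskTriangulation T) : Function.Injective (Q.centerMap T) := by
  have := hQ.nonobtuse.countable
  refine injective_of_isOpenMap_of_dense (himm.isOpenMap hT) Q.dense_compl_iUnion_segment
    fun x y hxy hgen => ?_
  obtain ⟨s, hs, hxs⟩ := exists_mem_openFace x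
  obtain ⟨t, ht, hyt⟩ := exists_mem_openFace y
  have hcard : t.card = 3 := le_antisymm (hT.1 t ht) <| not_lt.1 fun hlt => by
    obtain ⟨a, -, b, -, hab⟩ := Q.exists_mem_segment_of_mem_hull hlt (Q.centerMap_mem_hull hyt.1)
    exact hgen (mem_iUnion.2 ⟨(a, b), hxy ▸ hab⟩)
  by_contra hne
  refine hQ.centerMap_ne_of_disjoint himm hT hs ht hcard (Finset.disjoint_left.2 fun a ha hb => ?_)
    hxs.1 hyt hxy
  exact hne (himm.injOn_closedStar a ⟨s, hs, ha, hxs.1⟩ ⟨t, ht, hb, hyt.1⟩ hxy)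

end Injective

/-! ### The length–area inequality -/

/- Walks to the members of an enumeration, each a proper extension of the preceding one, fit
together into one infinite walk. -/
theorem exists_surjective_walk {W : Type*} [Countable W] [Nontrivial W] {H : SimpleGraph W}
    (hH : H.Preconnected) (a : W) :
    ∃ p : ℕ → W, p 0 = a ∧ (∀ k, H.Adj (p k) (p (k + 1))) ∧ Function.Surjective p := by
  have : Nonempty W := ⟨a⟩
  obtain ⟨e, he⟩ := exists_surjective_nat W
  have exists_extension (u v : W) : ∃ q : H.Walk u v, 0 < q.length := by
    obtain ⟨w, hw⟩ := hH.exists_adj_of_nontrivial u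
    exact ⟨.cons hw (hH w v).some, by simp⟩
  choose q hq using exists_extension
  let walk (n : ℕ) : H.Walk a (e n) :=
    n.rec (q a (e 0)) fun n p => p.append (q (e n) (e (n + 1)))
  have walk_succ (n : ℕ) : walk (n + 1) = (walk n).append (q (e n) (e (n + 1))) := rfl
  have lt_length (n : ℕ) : n < (walk n).length := by
    induction n with
    | zero => exact hq a (e 0)
    | succ n ih =>
      rw [walk_succ, SimpleGraph.Walk.length_append]
      have := hq (e n) (e (n + 1))
      omega
  have getVert_eq {m n k : ℕ} (hmn : m ≤ n) (hk : k ≤ (walk m).length) :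
      (walk n).getVert k = (walk m).getVert k ∧ k ≤ (walk n).length := by
    induction n, hmn using Nat.le_induction with
    | base => exact ⟨rfl, hk⟩
    | succ n _ ih =>
      rw [walk_succ, SimpleGraph.Walk.getVert_append', if_pos ih.2,
        SimpleGraph.Walk.length_append]
      exact ⟨ih.1, ih.2.trans (Nat.le_add_right _ _)⟩
  refine ⟨fun k => (walk k).getVert k, (walk 0).getVert_zero, fun k => ?_, fun w => ?_⟩
  · beta_reduce
    rw [← (getVert_eq k.le_succ (lt_length k).le).1]
    exact (walk (k + 1)).adj_getVert_succ (k.lt_succ_self.trans (lt_length (k + 1)))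
  · obtain ⟨n, rfl⟩ := he w
    refine ⟨(walk n).length, ?_⟩
    beta_reduce
    rw [(getVert_eq (lt_length n).le le_rfl).1, SimpleGraph.Walk.getVert_length]

theorem mem_curvesToInfinity_of_preconnected_induce [Countable V] {G : SimpleGraph V}
    {V₀ W : Set V} (hW : W.Infinite) (hG : (G.induce W).Preconnected) (hV₀ : (V₀ ∩ W).Nonempty) :
    W ∈ curvesToInfinity G V₀ := by
  obtain ⟨v, hv, hvW⟩ := hV₀
  have := hW.to_subtype
  obtain ⟨p, hp₀, hadj, hsurj⟩ := exists_surjective_walk hG ⟨v, hvW⟩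
  have range_eq : range (fun k => (p k : V)) = W := by
    rw [range_comp' Subtype.val p, hsurj.range_eq, image_univ, Subtype.range_coe]
  exact ⟨fun k => p k, by simpa only [hp₀] using hv, hadj, range_eq.symm ▸ hW, range_eq.symm⟩

open MeasureTheory in
theorem tsum_mul_sq_le {ι : Type*} (f g : ι → ℝ≥0∞) :
    (∑' i, f i * g i) ^ 2 ≤ (∑' i, f i ^ 2) * ∑' i, g i ^ 2 := by
  let _ : MeasurableSpace ι := ⊤
  have h := ENNReal.lintegral_mul_le_Lp_mul_Lq Measure.count Real.HolderConjugate.two_two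
    (measurable_from_top (f := f)).aemeasurable (measurable_from_top (f := g)).aemeasurable
  simp only [lintegral_count, Pi.mul_apply, ENNReal.rpow_two, one_div] at h
  calc (∑' i, f i * g i) ^ 2
      ≤ ((∑' i, f i ^ 2) ^ (2⁻¹ : ℝ) * (∑' i, g i ^ 2) ^ (2⁻¹ : ℝ)) ^ 2 := by gcongr
    _ = (∑' i, f i ^ 2) * ∑' i, g i ^ 2 := by
        rw [mul_pow, ← ENNReal.rpow_two, ← ENNReal.rpow_two, ← ENNReal.rpow_mul,
          ← ENNReal.rpow_mul, inv_mul_cancel₀ two_ne_zero, ENNReal.rpow_one, ENNReal.rpow_one]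

open MeasureTheory in
theorem Admissible.measure_le_tsum [Countable V] {Γ : Set (Set V)} {η : V → ℝ≥0}
    (hη : Admissible Γ η) {α : Type*} [MeasurableSpace α] (μ : Measure α) {J : Set α}
    {E : V → Set α} (hE : ∀ r ∈ J, ∃ γ ∈ Γ, ∀ v ∈ γ, r ∈ E v) :
    μ J ≤ ∑' v, η v * μ (E v) := by
  set φ : α → ℝ≥0∞ := fun r => ∑' v, η v * (toMeasurable μ (E v)).indicator 1 r
  have measurable (v : V) :
      Measurable fun r => (η v : ℝ≥0∞) * (toMeasurable μ (E v)).indicator 1 r :=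
    (measurable_one.indicator (measurableSet_toMeasurable _ _)).const_mul _
  have one_le : J ⊆ {r | 1 ≤ φ r} := fun r hr => by
    obtain ⟨γ, hγ, hγE⟩ := hE r hr
    refine (hη γ hγ).trans ?_
    rw [length, tsum_subtype γ fun v => (η v : ℝ≥0∞)]
    refine ENNReal.tsum_le_tsum (indicator_le fun v hv => ?_)
    simp [indicator_of_mem (subset_toMeasurable μ _ (hγE v hv))]
  calc μ J ≤ 1 * μ {r | 1 ≤ φ r} := by rw [one_mul]; exact measure_mono one_le
    _ ≤ ∫⁻ r, φ r ∂μ := mul_meas_ge_le_lintegral (Measurable.tsum measurable) 1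
    _ = ∑' v, η v * μ (E v) := by
        rw [lintegral_tsum fun v => (measurable v).aemeasurable]
        refine tsum_congr fun v => ?_
        rw [lintegral_const_mul _ (measurable_one.indicator (measurableSet_toMeasurable _ _)),
          lintegral_indicator_one (measurableSet_toMeasurable _ _), measure_toMeasurable]

open MeasureTheory in
theorem sq_measure_div_tsum_le_vertexModulus [Countable V] {Γ : Set (Set V)} {α : Type*}
    [MeasurableSpace α] (μ : Measure α) {J : Set α} {E : V → Set α}
    (hE : ∀ r ∈ J, ∃ γ ∈ Γ, ∀ v ∈ γ, r ∈ E v) :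
    μ J ^ 2 / ∑' v, μ (E v) ^ 2 ≤ vertexModulus Γ :=
  le_iInf₂ fun _ hη => ENNReal.div_le_of_le_mul <|
    (pow_le_pow_left' (hη.measure_le_tsum μ hE) 2).trans (tsum_mul_sq_le _ _)

/-! ### The center map of a parabolic immersed pattern is surjective -/

theorem not_sphere_subset_range {A : Type*} [TopologicalSpace A] [SimplyConnectedSpace A]
    [LocallyPathConnectedSpace A] {φ : A → ℂ} (hφ : IsInducing φ) {p : ℂ} (hp : p ∉ range φ)
    {r : ℝ} (hr : 0 < r) : ¬ Metric.sphere p r ⊆ range φ := by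
  intro hsub
  obtain ⟨g, hg, exp_g⟩ := exists_continuous_log (f := fun a => φ a - p)
    (hφ.continuous.sub continuous_const) fun a ha => hp ⟨a, sub_eq_zero.1 ha⟩
  choose σ hσ using fun z : Metric.sphere p r => hsub z.2
  have hσcont : Continuous σ :=
    hφ.continuous_iff.2 ((funext hσ : φ ∘ σ = Subtype.val) ▸ continuous_subtype_val)
  obtain ⟨z, hz⟩ := exists_exp_ne_sub_center hr (hg.comp hσcont)
  exact hz (by rw [Function.comp_apply, exp_g, hσ])

theorem exists_isPreconnected_not_closure_subset {X Y : Type*} [TopologicalSpace X]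
    [TopologicalSpace Y] [PreconnectedSpace X] [LocallyConnectedSpace X] {γ : X → Y}
    (hγ : Continuous γ) {Ω : Set Y} (hΩ : IsOpen Ω) {x : X} (hx : γ x ∈ Ω)
    (hexit : ¬ range γ ⊆ Ω) :
    ∃ A ⊆ Ω ∩ range γ, IsPreconnected A ∧ γ x ∈ A ∧ ¬ closure A ⊆ Ω := by
  set K := connectedComponentIn (γ ⁻¹' Ω) x
  have hxK : x ∈ K := mem_connectedComponentIn hx
  have hKΩ : K ⊆ γ ⁻¹' Ω := connectedComponentIn_subset _ _
  have hK : IsPreconnected K := isPreconnected_connectedComponentIn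
  refine ⟨γ '' K, subset_inter (image_subset_iff.2 hKΩ) (image_subset_range _ _),
    hK.image γ hγ.continuousOn, mem_image_of_mem γ hxK, fun h => hexit ?_⟩
  have isClosed : IsClosed K := isClosed_of_closure_subset <|
    hK.closure.subset_connectedComponentIn (subset_closure hxK)
      (image_subset_iff.1 ((image_closure_subset_closure_image hγ).trans h))
  have isOpen : IsOpen K := (hΩ.preimage hγ).connectedComponentIn
  have hKuniv : K = univ := IsClopen.eq_univ ⟨isClosed, isOpen⟩ ⟨x, hxK⟩
  rintro _ ⟨y, rfl⟩
  exact hKΩ (hKuniv ▸ mem_univ y)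

section Surjective

variable {T : AbstractSimplicialComplex V} {Q : DiskPattern V}

theorem openStar_subset_closedStar (v : V) : openStar T v ⊆ closedStar T v := fun x hx => by
  obtain ⟨s, hs, hxs⟩ := exists_mem_openFace x
  exact ⟨s, hs, by_contra fun h => (show 0 < x.1 v from hx).ne' (hxs.1 v h), hxs.1⟩

theorem DiskPattern.isClosed_image_closedStar (Q : DiskPattern V)
    [LocallyCompactSpace (geomRealization T)] (v : V) :
    IsClosed (Q.centerMap T '' closedStar T v) := by
  classical
  have finite_faces : {s | s ∈ T.faces ∧ v ∈ s}.Finite := by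
    refine (insert v (finite_setOf_adj (T := T) v).toFinset).powerset.finite_toSet.subset ?_
    rintro s ⟨hs, hv⟩
    refine Finset.mem_coe.2 (Finset.mem_powerset.2 fun w hw => ?_)
    obtain rfl | hwv := eq_or_ne w v
    · exact Finset.mem_insert_self _ _
    · exact Finset.mem_insert_of_mem ((Finite.mem_toFinset _).2 ⟨hwv.symm, s, hs, hv, hw⟩)
  have : Q.centerMap T '' closedStar T v = ⋃ s ∈ {s | s ∈ T.faces ∧ v ∈ s}, Q.hull s := by
    have : closedStar T v = ⋃ s ∈ {s | s ∈ T.faces ∧ v ∈ s}, closedFace T s := by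
      ext x
      simp [closedStar, and_assoc]
    rw [this, image_iUnion₂]
    exact iUnion₂_congr fun s hs => Q.image_closedFace hs.1
  rw [this]
  exact finite_faces.isClosed_biUnion fun s _ => Q.isClosed_hull s

/-- The part of the open star of `v` that the center map sends into the disk `3 Q(v)`. Unlike the
stars themselves, these sets have images of size comparable to the disks; they still cover the
realization. -/
def DiskPattern.coreStar (Q : DiskPattern V) (T : AbstractSimplicialComplex V) (v : V) :
    Set (geomRealization T) :=
  {x ∈ openStar T v | dist (Q.centerMap T x) (Q.disk v).center < 3 * (Q.disk v).radius}

theorem DiskPattern.isOpen_coreStar (Q : DiskPattern V) [LocallyCompactSpace (geomRealization T)]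
    (v : V) : IsOpen (Q.coreStar T v) :=
  (isOpen_openStar v).inter
    (isOpen_lt (Q.continuous_centerMap.dist continuous_const) continuous_const)

theorem DiskPattern.vertexPoint_mem_coreStar (Q : DiskPattern V) (v : V) :
    vertexPoint T v ∈ Q.coreStar T v := by
  simp [DiskPattern.coreStar, openStar, vertexPoint_apply_self, Q.centerMap_vertexPoint,
    (Q.disk v).radius_pos]

theorem DiskPattern.MetricallyRealizes.exists_mem_coreStar
    (hQ : Q.MetricallyRealizes (oneSkeleton T)) (x : geomRealization T) :
    ∃ v, x ∈ Q.coreStar T v := by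
  obtain ⟨s, hs, hx⟩ := exists_mem_openFace x
  obtain ⟨v, hv, hmax⟩ := s.exists_max_image (fun v => (Q.disk v).radius)
    (T.isRelLowerSet_faces hs).1
  have hull_subset : Q.hull s ⊆ Metric.closedBall (Q.disk v).center (2 * (Q.disk v).radius) := by
    refine convexHull_min ?_ (convex_closedBall _ _)
    rintro _ ⟨u, hu, rfl⟩
    exact Metric.mem_closedBall.2 (by linarith [hQ.dist_le_of_mem_face hs hu hv, hmax u hu])
  have := Metric.mem_closedBall.1 (hull_subset (Q.centerMap_mem_hull hx.1))
  exact ⟨v, hx.2 v hv, by linarith [(Q.disk v).radius_pos]⟩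

theorem DiskPattern.MetricallyRealizes.setOf_inter_coreStar_mem_curvesToInfinity
    (hQ : Q.MetricallyRealizes (oneSkeleton T)) [LocallyCompactSpace (geomRealization T)]
    (hopen : IsOpenMap (Q.centerMap T)) (hinj : Function.Injective (Q.centerMap T)) {A : Set ℂ}
    (hA : IsPreconnected A) (hAΩ : A ⊆ range (Q.centerMap T))
    (hAc : ¬ closure A ⊆ range (Q.centerMap T)) {V₀ : Set V} {v₀ : V} (hv₀ : v₀ ∈ V₀)
    (hA₀ : (Q.centerMap T ⁻¹' A ∩ Q.coreStar T v₀).Nonempty) :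
    {v | (Q.centerMap T ⁻¹' A ∩ Q.coreStar T v).Nonempty} ∈
      curvesToInfinity (oneSkeleton T) V₀ := by
  have := hQ.nonobtuse.countable
  refine mem_curvesToInfinity_of_preconnected_induce (fun hfin => hAc ?_)
    (preconnected_induce_oneSkeleton (hA.preimage_of_isOpenMap hinj hopen hAΩ) Q.isOpen_coreStar
      (fun _ _ hx => hx.1) fun x _ => mem_iUnion.2 (hQ.exists_mem_coreStar x)) ⟨v₀, hv₀, hA₀⟩
  refine (closure_minimal (fun z hz => ?_) (hfin.isClosed_biUnion fun v _ =>
    Q.isClosed_image_closedStar (T := T) v)).trans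
      (iUnion₂_subset fun v _ => image_subset_range _ _)
  obtain ⟨x, rfl⟩ := hAΩ hz
  obtain ⟨v, hv⟩ := hQ.exists_mem_coreStar x
  exact mem_biUnion (show v ∈ {v | _} from ⟨x, hz, hv⟩)
    (mem_image_of_mem _ (openStar_subset_closedStar v hv.1))

theorem DiskPattern.MetricallyRealizes.exists_mem_face_inter_closedBall_nonempty
    (hQ : Q.MetricallyRealizes (oneSkeleton T)) (himm : Q.IsImmersed T)
    (hT : IsOpenDiskTriangulation T) {p : ℂ} (hp : p ∉ range (Q.centerMap T)) {R : ℝ}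
    {s : Finset V} (hs : s ∈ T.faces) {x : geomRealization T} (hx : x ∈ closedFace T s)
    (hR : dist (Q.centerMap T x) p ≤ R) :
    ∃ j ∈ s, ((Q.disk j).toSet ∩ Metric.closedBall p R).Nonempty := by
  have hps : p ∉ Q.hull s := fun h => hp (image_subset_range _ _ (Q.image_closedFace hs ▸ h))
  obtain ⟨w, ⟨hw, -⟩, a, ha, b, hb, hab⟩ :=
    himm.exists_mem_segment_inter_segment hT hs (Q.centerMap_mem_hull hx) hps
  have hwp : w ∈ Metric.closedBall p R := (convex_closedBall p R).segment_subset hR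
    (Metric.mem_closedBall_self (dist_nonneg.trans hR)) hw
  obtain ha' | hb' : dist w (Q.disk a).center ≤ (Q.disk a).radius ∨
      dist w (Q.disk b).center ≤ (Q.disk b).radius := by
    by_contra! h
    linarith [dist_add_dist_of_mem_segment hab, hQ.dist_le_of_mem_face hs ha hb,
      dist_comm w (Q.disk a).center]
  exacts [⟨a, ha, w, ha', hwp⟩, ⟨b, hb, w, hb', hwp⟩]

theorem DiskPattern.MetricallyRealizes.near_or_adj_of_mem_openStar
    (hQ : Q.MetricallyRealizes (oneSkeleton T)) (himm : Q.IsImmersed T)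
    (hT : IsOpenDiskTriangulation T) {p : ℂ} (hp : p ∉ range (Q.centerMap T)) {R : ℝ}
    {v : V} {x : geomRealization T} (hx : x ∈ openStar T v) (hR : dist (Q.centerMap T x) p ≤ R) :
    ((Q.disk v).toSet ∩ Metric.closedBall p (R + 2)).Nonempty ∨
      ∃ j, (((Q.disk j).toSet ∩ Metric.closedBall p R).Nonempty ∧ 1 ≤ (Q.disk j).radius) ∧
        (oneSkeleton T).Adj j v := by
  obtain ⟨s, hs, hvs, hxs⟩ := openStar_subset_closedStar v hx
  obtain ⟨j, hj, w, hwj, hwp⟩ :=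
    hQ.exists_mem_face_inter_closedBall_nonempty himm hT hp hs hxs hR
  obtain rfl | hjv := eq_or_ne j v
  · exact Or.inl ⟨w, hwj, Metric.closedBall_subset_closedBall (by linarith) hwp⟩
  have hadj : (oneSkeleton T).Adj j v := ⟨hjv, s, hs, hj, hvs⟩
  obtain hr | hr := le_or_gt 1 (Q.disk j).radius
  · exact Or.inr ⟨j, ⟨⟨w, hwj, hwp⟩, hr⟩, hadj⟩
  · obtain ⟨y, hyj, hyv⟩ := exists_dist_le_le (Q.disk j).radius_pos.le (Q.disk v).radius_pos.le
      ((hQ.dist_le_of_adj hadj).trans_eq (add_comm _ _))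
    have hwj : dist w (Q.disk j).center ≤ (Q.disk j).radius := hwj
    have hyp : dist y p ≤ R + 2 := by
      linarith [dist_triangle4 y (Q.disk j).center w p, dist_comm y (Q.disk j).center,
        dist_comm w (Q.disk j).center, Metric.mem_closedBall.1 hwp]
    exact Or.inl ⟨y, hyv, hyp⟩

/-- The radii, up to `R`, of the circles around `p` that meet the image of `Q.coreStar T v`. -/
def DiskPattern.starRadii (Q : DiskPattern V) (T : AbstractSimplicialComplex V) (p : ℂ) (R : ℝ)
    (v : V) : Set ℝ :=
  (fun x => dist (Q.centerMap T x) p) '' Q.coreStar T v ∩ Iic R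

open MeasureTheory in
theorem DiskPattern.volume_starRadii_le (Q : DiskPattern V) (p : ℂ) {R : ℝ} (hR : 0 ≤ R) (v : V) :
    volume (Q.starRadii T p R v) ≤ ENNReal.ofReal ((6 + R) * min (Q.disk v).radius 1) := by
  have hr := (Q.disk v).radius_pos
  have subset_Icc : Q.starRadii T p R v ⊆ Icc 0 R := by
    rintro _ ⟨⟨x, -, rfl⟩, h⟩
    exact ⟨dist_nonneg, h⟩
  have subset_Icc' : Q.starRadii T p R v ⊆ Icc (dist (Q.disk v).center p - 3 * (Q.disk v).radius)
      (dist (Q.disk v).center p + 3 * (Q.disk v).radius) := by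
    rintro _ ⟨⟨x, ⟨-, hx⟩, rfl⟩, -⟩
    constructor
    · linarith [dist_triangle_left (Q.disk v).center p (Q.centerMap T x)]
    · linarith [dist_triangle (Q.centerMap T x) (Q.disk v).center p]
  obtain h | h := le_total (Q.disk v).radius 1
  · refine (measure_mono subset_Icc').trans ?_
    rw [Real.volume_Icc, min_eq_left h]
    exact ENNReal.ofReal_le_ofReal (by linarith [mul_nonneg hR hr.le])
  · refine (measure_mono subset_Icc).trans ?_
    rw [Real.volume_Icc, min_eq_right h]
    exact ENNReal.ofReal_le_ofReal (by linarith)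

open MeasureTheory in
theorem DiskPattern.MetricallyRealizes.tsum_sq_volume_starRadii_ne_top
    (hQ : Q.MetricallyRealizes (oneSkeleton T)) (himm : Q.IsImmersed T)
    (hT : IsOpenDiskTriangulation T) {p : ℂ} (hp : p ∉ range (Q.centerMap T)) {R : ℝ}
    (hR : 0 ≤ R) : ∑' v, volume (Q.starRadii T p R v) ^ 2 ≠ ⊤ := by
  have := hT.locallyCompactSpace
  set near : Set V := {v | ((Q.disk v).toSet ∩ Metric.closedBall p (R + 2)).Nonempty}
  set adjacent : Set V := ⋃ j ∈ {j | ((Q.disk j).toSet ∩ Metric.closedBall p R).Nonempty ∧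
    1 ≤ (Q.disk j).radius}, {v | (oneSkeleton T).Adj j v}
  have adjacent_finite : adjacent.Finite :=
    (hQ.nonobtuse.finite_setOf_one_le_radius p R).biUnion fun j _ => finite_setOf_adj j
  have support_subset :
      Function.support (fun v => volume (Q.starRadii T p R v) ^ 2) ⊆ near ∪ adjacent := by
    intro v hv
    obtain ⟨_, ⟨x, hx, rfl⟩, hxR⟩ : (Q.starRadii T p R v).Nonempty := by
      by_contra! h
      simp [h] at hv
    obtain h | ⟨j, hj, hjv⟩ := hQ.near_or_adj_of_mem_openStar himm hT hp hx.1 hxR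
    exacts [Or.inl h, Or.inr (mem_biUnion hj hjv)]
  have near_le : ∑' v : near, volume (Q.starRadii T p R v.1) ^ 2 ≤
      ENNReal.ofReal (6 + R) ^ 2 * (4 * ENNReal.ofReal (R + 2 + 2 * 1) ^ 2) := calc
    _ ≤ ∑' v : near, ENNReal.ofReal (6 + R) ^ 2 *
          ENNReal.ofReal (min (Q.disk v.1).radius 1) ^ 2 :=
        ENNReal.tsum_le_tsum fun v => by
          rw [← mul_pow, ← ENNReal.ofReal_mul (by positivity)]
          exact pow_le_pow_left' (Q.volume_starRadii_le p hR v.1) 2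
    _ ≤ _ := by
        rw [ENNReal.tsum_mul_left]
        exact mul_le_mul_right (hQ.nonobtuse.tsum_sq_le p one_pos) _
  have adjacent_ne_top : ∑' v : adjacent, volume (Q.starRadii T p R v.1) ^ 2 ≠ ⊤ := by
    have := adjacent_finite.fintype
    rw [tsum_fintype]
    exact ENNReal.sum_ne_top.2 fun v _ => ENNReal.pow_ne_top
      (ne_top_of_le_ne_top ENNReal.ofReal_ne_top (Q.volume_starRadii_le p hR v.1))
  rw [← tsum_subtype_eq_of_support_subset support_subset]
  exact ne_top_of_le_ne_top
    (ENNReal.add_ne_top.2 ⟨ne_top_of_le_ne_top (by finiteness) near_le, adjacent_ne_top⟩)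
    (ENNReal.tsum_union_le (fun v => volume (Q.starRadii T p R v) ^ 2) near adjacent)

/- The circle of radius `r` around the omitted point is not contained in the image, which is simply
connected. -/
theorem DiskPattern.MetricallyRealizes.exists_curve_subset_starRadii
    (hQ : Q.MetricallyRealizes (oneSkeleton T)) (himm : Q.IsImmersed T)
    (hT : IsOpenDiskTriangulation T) {p : ℂ} (hp : p ∉ range (Q.centerMap T)) {R r : ℝ}
    (hr : 0 < r) (hrR : r ≤ R) {V₀ : Set V} {v₀ : V} (hv₀ : v₀ ∈ V₀)
    (hrv₀ : r ∈ Q.starRadii T p R v₀) :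
    ∃ γ ∈ curvesToInfinity (oneSkeleton T) V₀, ∀ v ∈ γ, r ∈ Q.starRadii T p R v := by
  have := hT.locallyCompactSpace
  have hopen := himm.isOpenMap hT
  have hinj := hQ.centerMap_injective himm hT
  obtain ⟨e⟩ := hT.2
  have : ContractibleSpace (geomRealization T) :=
    have := Metric.contractibleSpace_ball (x := (0 : ℂ)) one_pos
    e.contractibleSpace
  have : LocallyPathConnectedSpace (geomRealization T) :=
    have : LocallyPathConnectedSpace (Metric.ball (0 : ℂ) 1) :=
      Metric.isOpen_ball.locallyPathConnectedSpace
    e.isOpenEmbedding.locallyPathConnectedSpace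
  have not_subset : ¬ range (circleMap p r) ⊆ range (Q.centerMap T) := by
    rw [range_circleMap, abs_of_pos hr]
    exact not_sphere_subset_range (IsOpenEmbedding.of_continuous_injective_isOpenMap
      Q.continuous_centerMap hinj hopen).isInducing hp hr
  obtain ⟨⟨x, hx, hxr⟩, -⟩ := hrv₀
  obtain ⟨θ, hθ⟩ : Q.centerMap T x ∈ range (circleMap p r) := by
    rwa [range_circleMap, abs_of_pos hr]
  obtain ⟨A, hA, hApre, hxA, hAc⟩ := exists_isPreconnected_not_closure_subset
    (continuous_circleMap p r) hopen.isOpen_range ⟨x, hθ.symm⟩ not_subset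
  obtain ⟨hAΩ, hAsphere⟩ := subset_inter_iff.1 hA
  rw [range_circleMap, abs_of_pos hr] at hAsphere
  rw [hθ] at hxA
  refine ⟨_, hQ.setOf_inter_coreStar_mem_curvesToInfinity hopen hinj hApre hAΩ hAc hv₀
    ⟨x, hxA, hx⟩, fun v ⟨y, hyA, hy⟩ => ⟨⟨y, hy, hAsphere hyA⟩, hrR⟩⟩

theorem DiskPattern.MetricallyRealizes.centerMap_surjective
    (hQ : Q.MetricallyRealizes (oneSkeleton T)) (himm : Q.IsImmersed T)
    (hT : IsOpenDiskTriangulation T) (hP : VELParabolic (oneSkeleton T)) :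
    Function.Surjective (Q.centerMap T) := by
  have := hQ.nonobtuse.countable
  have := hT.locallyCompactSpace
  obtain ⟨-, V₀, -, ⟨v₀, hv₀⟩, hvel⟩ := hP
  by_contra! hsurj
  obtain ⟨p, hp⟩ := not_forall.1 hsurj
  set q := (Q.disk v₀).center
  set R := dist q p
  obtain ⟨ρ, hρ, hball⟩ := Metric.isOpen_iff.1 (himm.isOpenMap hT _ (Q.isOpen_coreStar v₀)) q
    ⟨_, Q.vertexPoint_mem_coreStar v₀, Q.centerMap_vertexPoint v₀⟩
  have hρR : ρ ≤ R := not_lt.1 fun h => hp (image_subset_range _ _ (hball (Metric.mem_ball'.2 h)))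
  have modulus_pos := sq_measure_div_tsum_le_vertexModulus
    (Γ := curvesToInfinity (oneSkeleton T) V₀) MeasureTheory.volume (J := Ioo (R - ρ) R)
    (E := Q.starRadii T p R) fun r ⟨hρr, hrR⟩ => by
      have hr : 0 < r := by linarith
      obtain ⟨z, hqz, hzp⟩ := exists_dist_le_le (sub_nonneg.2 hrR.le) hr.le
        (add_sub_cancel r R).ge
      obtain ⟨x, hx, rfl⟩ := hball (Metric.mem_ball'.2 (by linarith))
      have hzr : dist (Q.centerMap T x) p = r :=
        hzp.antisymm (by linarith [dist_triangle q (Q.centerMap T x) p])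
      exact hQ.exists_curve_subset_starRadii himm hT hp hr hrR.le hv₀ ⟨⟨x, hx, hzr⟩, hrR.le⟩
  rw [ENNReal.inv_eq_top.1 hvel, nonpos_iff_eq_zero, ENNReal.div_eq_zero_iff] at modulus_pos
  have hJ : MeasureTheory.volume (Ioo (R - ρ) R) ≠ 0 := by simpa using hρ
  exact modulus_pos.elim (pow_ne_zero 2 hJ)
    (hQ.tsum_sq_volume_starRadii_ne_top himm hT hp dist_nonneg)

end Surjective

/-! ### Parabolic immersed patterns are locally finite -/

theorem DiskPattern.Nonobtuse.locallyFiniteIn_univ {T : AbstractSimplicialComplex V}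
    {Q : DiskPattern V} (hQ : Q.Nonobtuse) (hopen : IsOpenMap (Q.centerMap T))
    (hbij : Function.Bijective (Q.centerMap T)) : Q.LocallyFiniteIn univ := by
  refine ⟨fun _ => subset_univ _, fun K _ hK => ?_⟩
  obtain ⟨M, hM⟩ := hK.isBounded.subset_closedBall 0
  have stars_cover : Metric.closedBall (0 : ℂ) (M + 1) ⊆ ⋃ v, Q.centerMap T '' openStar T v :=
    fun z _ => by
      obtain ⟨x, rfl⟩ := hbij.surjective z
      obtain ⟨v, hv⟩ := exists_mem_openStar x
      exact mem_iUnion.2 ⟨v, mem_image_of_mem _ hv⟩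
  obtain ⟨t, ht⟩ := (isCompact_closedBall (0 : ℂ) (M + 1)).elim_finite_subcover _
    (fun v => hopen _ (isOpen_openStar v)) stars_cover
  refine ((hQ.finite_setOf_one_le_radius 0 M).union t.finite_toSet).subset ?_
  rintro v ⟨z, hz, hzK⟩
  obtain hr | hr := le_or_gt 1 (Q.disk v).radius
  · exact Or.inl ⟨⟨z, hz, hM hzK⟩, hr⟩
  · have hzv : dist z (Q.disk v).center ≤ (Q.disk v).radius := hz
    have hzM : dist z 0 ≤ M := hM hzK
    have center_mem : (Q.disk v).center ∈ Metric.closedBall (0 : ℂ) (M + 1) :=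
      Metric.mem_closedBall.2 (by linarith [dist_triangle_left (Q.disk v).center 0 z])
    obtain ⟨w, hw, x, hx, hxv⟩ := mem_iUnion₂.1 (ht center_mem)
    obtain rfl := hbij.injective (hxv.trans (Q.centerMap_vertexPoint v).symm)
    obtain rfl | hwv := eq_or_ne w v
    · exact Or.inr hw
    · exact absurd (vertexPoint_apply_of_ne hwv) (ne_of_gt hx)

theorem DiskPattern.MetricallyRealizes.le_contactGraph {Q : DiskPattern V} {G : SimpleGraph V}
    (hQ : Q.MetricallyRealizes G) : G ≤ Q.contactGraph := fun u v h =>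
  (Q.contactGraph_adj_iff u v).2 ⟨h.ne, hQ.dist_le_of_adj h⟩

theorem corollary6p2_general {T : AbstractSimplicialComplex V} (hT : IsOpenDiskTriangulation T)
    {Q : DiskPattern V} (hQ : Q.MetricallyRealizes (oneSkeleton T)) :
    (Q.LocallyFiniteIn univ → VELParabolic (oneSkeleton T)) ∧
      (Q.IsImmersed T → VELParabolic (oneSkeleton T) → Q.LocallyFiniteIn univ) := by
  have := hT.connectedSpace
  constructor
  · intro hlf
    exact hlf.velParabolic hQ.nonobtuse oneSkeleton_connected hQ.le_contactGraph
  · intro himm hP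
    exact hQ.nonobtuse.locallyFiniteIn_univ (himm.isOpenMap hT)
      ⟨hQ.centerMap_injective himm hT, hQ.centerMap_surjective himm hT hP⟩

end HePattern

end

theorem corollary6p2 {V : Type*} (T : AbstractSimplicialComplex V)
    (hT : IsOpenDiskTriangulation T) (G : SimpleGraph V) (hG : G = oneSkeleton T)
    (Θ : G.edgeSet → ℝ) (hΘ : ∀ e, Θ e ∈ Set.Icc 0 (Real.pi / 2))
    (Q : DiskPattern V) (hQ : Q.Realizes Θ) :
    (Q.LocallyFiniteIn Set.univ → VELParabolic G) ∧
      (Q.IsImmersed T → VELParabolic G → Q.LocallyFiniteIn Set.univ) := by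
  subst hG
  exact corollary6p2_general hT (hQ.metricallyRealizes hΘ)
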